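/- All manifolds are smooth, finite-dimensional, Hausdorff and second countable, without boundary; metrics, tensor fields and maps are smooth. **Definitions.** Let $(M,h)$ be a manifold with a (semi-)Riemannian metric $h$ (a nondegenerate symmetric $(0,2)$-tensor field) and Levi-Civita connection $\overset{M}{\nabla}$. An *almost product structure* on $M$ is a $(1,1)$-tensor field $P$ with $P^2=I$; its *eigendistributions* are $\overset{M}{\mathcal E}_{(1)}=\ker(P-I)$ and $\overset{M}{\mathcal E}_{(-1)}=\ker(P+I)$. The triple $(M,h,P)$ is * an *almost product Riemannian manifold* if $h$ is positive definite and $h(PX,Y)=h(X,PY)$ for all $X,Y$; * an *almost para-Hermitian manifold* if $h$ is nondegenerate and $h(PX,Y)=-h(X,PY)$ for all $X,Y$; * a *semi decomposable product Riemannian manifold* if it is almost product Riemannian and $\operatorname{div}P=\sum_i(\nabla_{e_i}P)e_i=0$, where $\{e_i\}$ is any local $h$-orthonormal frame of $TM$. A distribution $D$ on a (semi-)Riemannian manifold is *Vidal* if $\nabla_XX\in\Gamma(D)$ for every $X\in\Gamma(D)$. A smooth map $F:(M,h,P)\to(N,g,Q)$ between manifolds with almost product structures is *$(P,Q)$-paraholomorphic*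 if $F_*\circ P=Q\circ F_*$ on all of $TM$, and *$-(P,Q)$-paraholomorphic* if $F_*\circ P=-Q\circ F_*$ on all of $TM$; it is *$\pm(P,Q)$-paraholomorphic* if it is one or the other. The second fundamental form of a smooth map $F:(M,h)\to(N,g)$ is $(\nabla F_*)(X,Y)=\overset{N}{\nabla}_{F_*X}F_*Y-F_*(\overset{M}{\nabla}_XY)$, where in the first term $F_*Y$ is differentiated as a vector field along $F$ by the pullback of $\overset{N}{\nabla}$. If $D$ is a distribution on $M$ on which $h$ is nondegenerate, the *$D$-tension field* of $F$ is $$\mathcal T_D(F)=\sum_{i,j}h^{ij}(\nabla F_*)(e_i,e_j),\qquad (h^{ij})=\big(h(e_i,e_j)\big)^{-1},$$ where $\{e_i\}$ is a local frame of $D$. The map $F$ is *harmonic* if $\mathcal T_{TM}(F)=0$; when $(M,h,P)$ is almost product Riemannian, $F$ is *plus-eigen harmonic* if $\mathcal T_D(F)=0$ for $D=\overset{M}{\mathcal E}_{(1)}$ and *minus-eigen harmonic* if $\mathcal T_D(F)=0$ for $D=\overset{M}{\mathcal E}_{(-1)}$. **Theorem.** Let $F:(M,h,P)\to(N,g,Q)$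 be a $\pm(P,Q)$-paraholomorphic map from a semi decomposable product Riemannian manifold $M$ into a manifold $N$ which is either almost product Riemannian or almost para-Hermitian, and suppose that both eigendistributions $\overset{N}{\mathcal E}_{(1)}$ and $\overset{N}{\mathcal E}_{(-1)}$ of $Q$ are Vidal. Then the following are equivalent: i) $F$ is harmonic; ii) $F$ is plus-eigen harmonic and minus-eigen harmonic. -/

import Mathlib

open Bundle Manifold
open scoped ContDiff

noncomputable section

set_option linter.unusedSectionVars false

/-- A smooth semi-Riemannian metric: a smooth symmetric `(0,2)`-tensor field, nondegenerate at every
point. -/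
structure SemiRiemannianMetric (E : Type*) [NormedAddCommGroup E] [NormedSpace ℝ E]
    (M : Type*) [TopologicalSpace M] [ChartedSpace E M] [IsManifold 𝓘(ℝ, E) ∞ M] where
  val : ∀ x : M, TangentSpace 𝓘(ℝ, E) x →L[ℝ] TangentSpace 𝓘(ℝ, E) x →L[ℝ] ℝ
  symm : ∀ x u v, val x u v = val x v u
  nondegenerate : ∀ x u, (∀ v, val x u v = 0) → u = 0
  contMDiff : ContMDiff 𝓘(ℝ, E) (𝓘(ℝ, E).prod 𝓘(ℝ, E →L[ℝ] E →L[ℝ] ℝ)) ∞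
    (fun x ↦ TotalSpace.mk' (E →L[ℝ] E →L[ℝ] ℝ)
      (E := fun x : M ↦ TangentSpace 𝓘(ℝ, E) x →L[ℝ] TangentSpace 𝓘(ℝ, E) x →L[ℝ] ℝ) x (val x))

/-- A smooth `(1,1)`-tensor field `P` with `P ∘ P` the identity. -/
structure AlmostProductStructure (E : Type*) [NormedAddCommGroup E] [NormedSpace ℝ E]
    (M : Type*) [TopologicalSpace M] [ChartedSpace E M] [IsManifold 𝓘(ℝ, E) ∞ M] where
  val : ∀ x : M, TangentSpace 𝓘(ℝ, E) x →L[ℝ] TangentSpace 𝓘(ℝ, E) x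
  apply_apply : ∀ x u, val x (val x u) = u
  contMDiff : ContMDiff 𝓘(ℝ, E) (𝓘(ℝ, E).prod 𝓘(ℝ, E →L[ℝ] E)) ∞
    (fun x ↦ TotalSpace.mk' (E →L[ℝ] E)
      (E := fun x : M ↦ TangentSpace 𝓘(ℝ, E) x →L[ℝ] TangentSpace 𝓘(ℝ, E) x) x (val x))

section Connection

variable {E : Type*} [NormedAddCommGroup E] [NormedSpace ℝ E]
  {M : Type*} [TopologicalSpace M] [ChartedSpace E M] [IsManifold 𝓘(ℝ, E) ∞ M]

variable (E) in
/-- Components of tangent vectors at `x` in the preferred chart at `x`. -/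
def tangentCoord (x : M) : TangentSpace 𝓘(ℝ, E) x ≃L[ℝ] E :=
  (trivializationAt E (TangentSpace 𝓘(ℝ, E) : M → Type _) x).continuousLinearEquivAt ℝ x
    (FiberBundle.mem_baseSet_trivializationAt' x)

theorem tangentCoord_apply (x : M) (v : TangentSpace 𝓘(ℝ, E) x) :
    tangentCoord E x v = (trivializationAt E (TangentSpace 𝓘(ℝ, E) : M → Type _) x ⟨x, v⟩).2 := rfl

theorem tangentCoord_symm_apply (x : M) (v : E) :
    (tangentCoord E x).symm v =
      (trivializationAt E (TangentSpace 𝓘(ℝ, E) : M → Type _) x).symmL ℝ x v := by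
  rw [tangentCoord, Trivialization.symm_continuousLinearEquivAt_eq]

theorem tangentCoord_eq (x : M) (v : TangentSpace 𝓘(ℝ, E) x) : tangentCoord E x v = v :=
  (tangentBundleCore 𝓘(ℝ, E) M).coordChange_self (achart E x) x (mem_chart_source E x) v

/-- Components of a vector field in the preferred chart at `x`, as a function near `x`. -/
def vectorInChart (x : M) (Y : ∀ y : M, TangentSpace 𝓘(ℝ, E) y) (y : M) : E :=
  (trivializationAt E (TangentSpace 𝓘(ℝ, E) : M → Type _) x ⟨y, Y y⟩).2

theorem mdifferentiableAt_vectorInChart {x : M} {Y : ∀ y : M, TangentSpace 𝓘(ℝ, E) y}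
    (hY : MDiffAt (T% Y) x) : MDiffAt (vectorInChart x Y) x :=
  (mdifferentiableAt_section _ _).1 hY

theorem vectorInChart_add (x : M) (Y Z : ∀ y : M, TangentSpace 𝓘(ℝ, E) y) :
    vectorInChart x (Y + Z) =ᶠ[nhds x] vectorInChart x Y + vectorInChart x Z := by
  filter_upwards [(trivializationAt E (TangentSpace 𝓘(ℝ, E) : M → Type _) x).open_baseSet.mem_nhds
    (FiberBundle.mem_baseSet_trivializationAt' x)] with y hy
  exact ((trivializationAt E (TangentSpace 𝓘(ℝ, E) : M → Type _) x).linear ℝ hy).map_add _ _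

theorem vectorInChart_smul (x : M) (f : M → ℝ) (Y : ∀ y : M, TangentSpace 𝓘(ℝ, E) y) :
    vectorInChart x (f • Y) =ᶠ[nhds x] f • vectorInChart x Y := by
  filter_upwards [(trivializationAt E (TangentSpace 𝓘(ℝ, E) : M → Type _) x).open_baseSet.mem_nhds
    (FiberBundle.mem_baseSet_trivializationAt' x)] with y hy
  exact ((trivializationAt E (TangentSpace 𝓘(ℝ, E) : M → Type _) x).linear ℝ hy).map_smul _ _

theorem hasFDerivAt_inChart {V : Type*} [NormedAddCommGroup V] [NormedSpace ℝ V] {f : M → V}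
    {x : M} (hf : MDiffAt f x) :
    HasFDerivAt (f ∘ (extChartAt 𝓘(ℝ, E) x).symm)
      (mvfderiv 𝓘(ℝ, E) f x : E →L[ℝ] V) (extChartAt 𝓘(ℝ, E) x x) := by
  have h1 := hf.hasMFDerivAt.2
  rw [modelWithCornersSelf_coe, Set.range_id] at h1
  exact hasFDerivWithinAt_univ.1 h1

theorem hasFDerivAt_inChart' {V : Type*} [NormedAddCommGroup V] [NormedSpace ℝ V] {f : M → V}
    {x : M} (hf : MDiffAt f x) {f' : E →L[ℝ] V}
    (h : HasFDerivAt (f ∘ (extChartAt 𝓘(ℝ, E) x).symm) f' (extChartAt 𝓘(ℝ, E) x x)) :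
    (mvfderiv 𝓘(ℝ, E) f x : E →L[ℝ] V) = f' :=
  HasFDerivAt.unique (𝕜 := ℝ) (E := E) (F := V) (hasFDerivAt_inChart hf) h

theorem mvfderiv_congr {V : Type*} [NormedAddCommGroup V] [NormedSpace ℝ V] {f g : M → V} {x : M}
    (hf : f =ᶠ[nhds x] g) : mvfderiv 𝓘(ℝ, E) f x = mvfderiv 𝓘(ℝ, E) g x := by
  have := hf.mfderiv_eq (I := 𝓘(ℝ, E)) (I' := 𝓘(ℝ, V))
  ext u
  exact congrArg (fun f ↦ f u) this

namespace SemiRiemannianMetric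

variable (h : SemiRiemannianMetric E M)

/-- Components of the metric in the preferred chart at `x`, as a function of the point `y` near `x`. -/
def inChart (x y : M) : E →L[ℝ] E →L[ℝ] ℝ :=
  (trivializationAt (E →L[ℝ] E →L[ℝ] ℝ)
    (fun x : M ↦ TangentSpace 𝓘(ℝ, E) x →L[ℝ] TangentSpace 𝓘(ℝ, E) x →L[ℝ] ℝ) x ⟨y, h.val y⟩).2

theorem inChart_apply {x y : M}
    (hy : y ∈ (trivializationAt E (TangentSpace 𝓘(ℝ, E) : M → Type _) x).baseSet) (v w : E) :
    h.inChart x y v w =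
      h.val y ((trivializationAt E (TangentSpace 𝓘(ℝ, E) : M → Type _) x).symmL ℝ y v)
        ((trivializationAt E (TangentSpace 𝓘(ℝ, E) : M → Type _) x).symmL ℝ y w) := by
  have h2 : y ∈ (trivializationAt (E →L[ℝ] ℝ)
      (fun x : M ↦ TangentSpace 𝓘(ℝ, E) x →L[ℝ] ℝ) x).baseSet := by
    rw [hom_trivializationAt_baseSet]
    exact ⟨hy, by simp⟩
  simp only [inChart, hom_trivializationAt_apply, ContinuousLinearMap.inCoordinates,
    ContinuousLinearMap.comp_apply]
  rw [Trivialization.continuousLinearMapAt_apply, Trivialization.linearMapAt_apply, if_pos h2,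
    hom_trivializationAt_apply]
  simp [ContinuousLinearMap.inCoordinates]

theorem inChart_self (x : M) (v w : E) : h.inChart x x v w =
    h.val x ((tangentCoord E x).symm v) ((tangentCoord E x).symm w) := by
  rw [tangentCoord_symm_apply, tangentCoord_symm_apply]
  exact h.inChart_apply (FiberBundle.mem_baseSet_trivializationAt' x) v w

/-- The partial derivative `∂_u (h(v, w))` at `x`, for constant `u`, `v`, `w` in the chart at `x`. -/
def derivInChart (x : M) (u v w : E) : ℝ :=
  mvfderiv 𝓘(ℝ, E) (h.inChart x) x ((tangentCoord E x).symm u) v w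

theorem mdifferentiableAt_inChart (x : M) : MDiffAt (h.inChart x) x := by
  have := (h.contMDiff.mdifferentiable (by simp) x)
  exact (mdifferentiableAt_section _ _).1 this

theorem inChart_symm {x y : M}
    (hy : y ∈ (trivializationAt E (TangentSpace 𝓘(ℝ, E) : M → Type _) x).baseSet) (v w : E) :
    h.inChart x y v w = h.inChart x y w v := by
  rw [h.inChart_apply hy, h.inChart_apply hy, h.symm]

theorem derivInChart_eq (x : M) (u v w : E) : h.derivInChart x u v w =
    mvfderiv 𝓘(ℝ, E) (fun y ↦ h.inChart x y v w) x ((tangentCoord E x).symm u) := by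
  have h1 := ((hasFDerivAt_inChart (h.mdifferentiableAt_inChart x)).clm_apply
    (hasFDerivAt_const v _)).clm_apply (hasFDerivAt_const w _)
  have h2 := hasFDerivAt_inChart' (((h.mdifferentiableAt_inChart x).clm_apply
        (mdifferentiableAt_const (c := v))).clm_apply (mdifferentiableAt_const (c := w))) h1
  have h3 := congrArg (fun f : E →L[ℝ] ℝ ↦ f ((tangentCoord E x).symm u)) h2
  simp only [ContinuousLinearMap.comp_zero, zero_add] at h3
  exact h3.symm

theorem derivInChart_symm (x : M) (u v w : E) :
    h.derivInChart x u v w = h.derivInChart x u w v := by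
  rw [derivInChart_eq, derivInChart_eq, mvfderiv_congr]
  filter_upwards [(trivializationAt E (TangentSpace 𝓘(ℝ, E) : M → Type _) x).open_baseSet.mem_nhds
    (FiberBundle.mem_baseSet_trivializationAt' x)] with y hy
  exact h.inChart_symm hy v w

theorem derivInChart_add₁ (x : M) (u u' v w : E) :
    h.derivInChart x (u + u') v w = h.derivInChart x u v w + h.derivInChart x u' v w := by
  simp only [derivInChart_eq, map_add]

theorem derivInChart_smul₁ (x : M) (c : ℝ) (u v w : E) :
    h.derivInChart x (c • u) v w = c * h.derivInChart x u v w := by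
  simp only [derivInChart_eq, map_smul, smul_eq_mul]

theorem derivInChart_add₂ (x : M) (u v v' w : E) :
    h.derivInChart x u (v + v') w = h.derivInChart x u v w + h.derivInChart x u v' w := by
  simp only [derivInChart, map_add, add_apply]

theorem derivInChart_smul₂ (x : M) (c : ℝ) (u v w : E) :
    h.derivInChart x u (c • v) w = c * h.derivInChart x u v w := by
  simp only [derivInChart, map_smul, smul_apply, smul_eq_mul]

theorem derivInChart_add₃ (x : M) (u v w w' : E) :
    h.derivInChart x u v (w + w') = h.derivInChart x u v w + h.derivInChart x u v w' := by
  simp only [derivInChart, map_add]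

theorem derivInChart_smul₃ (x : M) (c : ℝ) (u v w : E) :
    h.derivInChart x u v (c • w) = c * h.derivInChart x u v w := by
  simp only [derivInChart, map_smul, smul_eq_mul]

variable [FiniteDimensional ℝ E]

/-- Christoffel symbols of the first kind at `x` in the chart at `x`:
`w ↦ (∂_u h(v, w) + ∂_v h(u, w) - ∂_w h(u, v)) / 2`. -/
def christoffelFirst (x : M) (u v : E) : E →L[ℝ] ℝ :=
  LinearMap.toContinuousLinearMap
    { toFun w :=
        (1 / 2) * (h.derivInChart x u v w + h.derivInChart x v u w - h.derivInChart x w u v)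
      map_add' w w' := by
        simp only [derivInChart_add₁, derivInChart_add₃]; ring
      map_smul' c w := by
        simp only [derivInChart_smul₁, derivInChart_smul₃, smul_eq_mul, RingHom.id_apply]; ring }

theorem christoffelFirst_apply (x : M) (u v w : E) : h.christoffelFirst x u v w =
    (1 / 2) * (h.derivInChart x u v w + h.derivInChart x v u w - h.derivInChart x w u v) := rfl

/-- Lowering an index with the metric at `x`, in the chart at `x`. -/
def flat (x : M) : E ≃L[ℝ] (E →L[ℝ] ℝ) :=
  (LinearMap.linearEquivOfInjective (h.inChart x x : E →ₗ[ℝ] (E →L[ℝ] ℝ))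
    (by
      rw [injective_iff_map_eq_zero]
      intro v hv
      have : (tangentCoord E x).symm v = 0 := by
        refine h.nondegenerate x _ fun w ↦ ?_
        have := h.inChart_self x v (tangentCoord E x w)
        simp only [ContinuousLinearEquiv.symm_apply_apply] at this
        rw [← this]
        exact congrArg (fun f : E →L[ℝ] ℝ ↦ f (tangentCoord E x w)) hv
      simpa using this)
    (by
      rw [← LinearEquiv.finrank_eq (LinearMap.toContinuousLinearMap (𝕜 := ℝ) (E := E) (F' := ℝ))]
      exact (Subspace.dual_finrank_eq).symm)).toContinuousLinearEquiv

theorem flat_apply (x : M) (v w : E) : h.flat x v w = h.inChart x x v w := by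
  simp [flat]

/-- Christoffel symbols (of the second kind) `Γ(u, v)` at `x` in the chart at `x`. -/
def christoffel (x : M) : E →L[ℝ] E →L[ℝ] E :=
  (LinearMap.mk₂ ℝ (fun u v ↦ (h.flat x).symm (h.christoffelFirst x u v))
    (fun u u' v ↦ by
      rw [← map_add]; congr 1; ext w
      simp only [christoffelFirst_apply, derivInChart_add₁, derivInChart_add₂, add_apply]; ring)
    (fun c u v ↦ by
      rw [← map_smul]; congr 1; ext w
      simp only [christoffelFirst_apply, derivInChart_smul₁, derivInChart_smul₂, smul_apply,
        smul_eq_mul]; ring)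
    (fun u v v' ↦ by
      rw [← map_add]; congr 1; ext w
      simp only [christoffelFirst_apply, derivInChart_add₁, derivInChart_add₂, derivInChart_add₃,
        add_apply]; ring)
    (fun c u v ↦ by
      rw [← map_smul]; congr 1; ext w
      simp only [christoffelFirst_apply, derivInChart_smul₁, derivInChart_smul₂,
        derivInChart_smul₃, smul_apply, smul_eq_mul]; ring)).toContinuousBilinearMap

theorem christoffel_apply (x : M) (u v : E) :
    h.christoffel x u v = (h.flat x).symm (h.christoffelFirst x u v) := by
  simp [christoffel]

theorem inChart_christoffel (x : M) (u v w : E) :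
    h.inChart x x (h.christoffel x u v) w = h.christoffelFirst x u v w := by
  rw [← flat_apply, christoffel_apply, ContinuousLinearEquiv.apply_symm_apply]

/-- The Levi-Civita connection: `∇_u Y = dY(u) + Γ(u, Y)` at `x`, in the preferred chart at `x`.
Here `h.leviCivita Y x u` is `∇_u Y`. It is torsion-free and metric, see below. -/
def leviCivita : CovariantDerivative 𝓘(ℝ, E) E (TangentSpace 𝓘(ℝ, E) : M → Type _) where
  toFun Y x := ((tangentCoord E x).symm : E →L[ℝ] TangentSpace 𝓘(ℝ, E) x) ∘L
    (mvfderiv 𝓘(ℝ, E) (vectorInChart x Y) x +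
      (h.christoffel x).flip (tangentCoord E x (Y x)) ∘L
        (tangentCoord E x : TangentSpace 𝓘(ℝ, E) x →L[ℝ] E))
  isCovariantDerivativeOnUniv := by
    constructor
    · intro Y Z x hY hZ _
      have e : mvfderiv 𝓘(ℝ, E) (vectorInChart x (Y + Z)) x =
          mvfderiv 𝓘(ℝ, E) (vectorInChart x Y + vectorInChart x Z) x :=
        mvfderiv_congr (vectorInChart_add x Y Z)
      rw [e, mvfderiv_add (mdifferentiableAt_vectorInChart hY) (mdifferentiableAt_vectorInChart hZ)]
      ext u
      simp
      abel
    · intro Y f x hY hf _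
      have e : mvfderiv 𝓘(ℝ, E) (vectorInChart x (f • Y)) x =
          mvfderiv 𝓘(ℝ, E) (f • vectorInChart x Y) x :=
        mvfderiv_congr (vectorInChart_smul x f Y)
      rw [e, mvfderiv_smul hf (mdifferentiableAt_vectorInChart hY)]
      have e2 : vectorInChart x Y x = tangentCoord E x (Y x) := rfl
      ext u
      simp [e2]
      abel

theorem leviCivita_apply (Y : ∀ y : M, TangentSpace 𝓘(ℝ, E) y) (x : M)
    (u : TangentSpace 𝓘(ℝ, E) x) : h.leviCivita Y x u = (tangentCoord E x).symm
      (mvfderiv 𝓘(ℝ, E) (vectorInChart x Y) x u +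
        h.christoffel x (tangentCoord E x u) (tangentCoord E x (Y x))) := rfl

/-- The Levi-Civita connection is torsion-free. -/
theorem leviCivita_torsion (Y Z : ∀ y : M, TangentSpace 𝓘(ℝ, E) y) (x : M)
    (hY : MDiffAt (T% Y) x) (hZ : MDiffAt (T% Z) x) :
    h.leviCivita Z x (Y x) - h.leviCivita Y x (Z x) = VectorField.mlieBracket 𝓘(ℝ, E) Y Z x := by
  have hc : ∀ u v, h.christoffel x u v = h.christoffel x v u := by
    intro u v
    rw [christoffel_apply, christoffel_apply]
    congr 1
    ext w
    rw [christoffelFirst_apply, christoffelFirst_apply, h.derivInChart_symm x w u v]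
    ring
  have hpull : ∀ W : ∀ y : M, TangentSpace 𝓘(ℝ, E) y,
      VectorField.mpullbackWithin 𝓘(ℝ, E) 𝓘(ℝ, E) (extChartAt 𝓘(ℝ, E) x).symm W
        (Set.range 𝓘(ℝ, E)) =ᶠ[nhds (extChartAt 𝓘(ℝ, E) x x)]
      vectorInChart x W ∘ (extChartAt 𝓘(ℝ, E) x).symm := by
    intro W
    filter_upwards [extChartAt_target_mem_nhds (I := 𝓘(ℝ, E)) x] with y hy
    have hs : (extChartAt 𝓘(ℝ, E) x).symm y ∈ (chartAt E x).source := by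
      have := (extChartAt 𝓘(ℝ, E) x).map_target hy
      rwa [extChartAt_source] at this
    have hs' : (extChartAt 𝓘(ℝ, E) x).symm y ∈
        (trivializationAt E (TangentSpace 𝓘(ℝ, E) : M → Type _) x).baseSet := by
      rwa [TangentBundle.trivializationAt_baseSet]
    have h1 := TangentBundle.continuousLinearMapAt_trivializationAt (I := 𝓘(ℝ, E)) hs
    have h2 := ContinuousLinearMap.inverse_eq
      (mfderivWithin_extChartAt_symm_comp_mfderiv_extChartAt (I := 𝓘(ℝ, E)) hy)
      (mfderiv_extChartAt_comp_mfderivWithin_extChartAt_symm (I := 𝓘(ℝ, E)) hy)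
    rw [VectorField.mpullbackWithin_apply, h2]
    have h5 : Trivialization.continuousLinearMapAt ℝ
        (trivializationAt E (TangentSpace 𝓘(ℝ, E) : M → Type _) x) ((extChartAt 𝓘(ℝ, E) x).symm y)
          (W ((extChartAt 𝓘(ℝ, E) x).symm y)) =
        (vectorInChart x W ∘ (extChartAt 𝓘(ℝ, E) x).symm) y := by
      rw [Trivialization.continuousLinearMapAt_apply, Trivialization.linearMapAt_apply, if_pos hs']
      rfl
    rw [← h5]
    exact congrArg (fun f ↦ f (W ((extChartAt 𝓘(ℝ, E) x).symm y))) h1.symm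
  have h3 : ((mfderiv 𝓘(ℝ, E) 𝓘(ℝ, E) (extChartAt 𝓘(ℝ, E) x) x)).inverse =
      ((tangentCoord E x).symm : E →L[ℝ] TangentSpace 𝓘(ℝ, E) x) := by
    have h6 : ((trivializationAt E (TangentSpace 𝓘(ℝ, E) : M → Type _) x).continuousLinearMapAt
        ℝ x).inverse = ((tangentCoord E x).symm : E →L[ℝ] TangentSpace 𝓘(ℝ, E) x) := by
      rw [← Trivialization.coe_continuousLinearEquivAt_eq' _
        (FiberBundle.mem_baseSet_trivializationAt' x)]
      exact ContinuousLinearMap.inverse_equiv _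
    rw [← h6]
    exact congrArg ContinuousLinearMap.inverse
      (TangentBundle.continuousLinearMapAt_trivializationAt (I := 𝓘(ℝ, E))
        (mem_chart_source E x)).symm
  have h7 : VectorField.mlieBracket 𝓘(ℝ, E) Y Z x = (tangentCoord E x).symm
      (VectorField.lieBracket ℝ (vectorInChart x Y ∘ (extChartAt 𝓘(ℝ, E) x).symm)
        (vectorInChart x Z ∘ (extChartAt 𝓘(ℝ, E) x).symm) (extChartAt 𝓘(ℝ, E) x x)) := by
    rw [← (hpull Y).lieBracket_vectorField_eq (hpull Z)]
    have h8 : (extChartAt 𝓘(ℝ, E) x).symm ⁻¹' Set.univ ∩ Set.range 𝓘(ℝ, E) = Set.univ := by simp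
    have h11 := VectorField.lieBracketWithin_univ (𝕜 := ℝ) (E := E)
      (V := VectorField.mpullbackWithin 𝓘(ℝ, E) 𝓘(ℝ, E) (extChartAt 𝓘(ℝ, E) x).symm Y
        (Set.range 𝓘(ℝ, E)))
      (W := VectorField.mpullbackWithin 𝓘(ℝ, E) 𝓘(ℝ, E) (extChartAt 𝓘(ℝ, E) x).symm Z
        (Set.range 𝓘(ℝ, E)))
    rw [← h11, ← h8]
    exact congrArg (fun f : E →L[ℝ] TangentSpace 𝓘(ℝ, E) x ↦ f _) h3
  have h9 : ∀ W : ∀ y : M, TangentSpace 𝓘(ℝ, E) y,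
      (vectorInChart x W ∘ (extChartAt 𝓘(ℝ, E) x).symm) (extChartAt 𝓘(ℝ, E) x x) = W x := by
    intro W
    rw [Function.comp_apply, extChartAt_to_inv]
    exact tangentCoord_eq x (W x)
  have hd : ∀ W : ∀ y : M, TangentSpace 𝓘(ℝ, E) y, MDiffAt (T% W) x →
      fderiv ℝ (vectorInChart x W ∘ (extChartAt 𝓘(ℝ, E) x).symm) (extChartAt 𝓘(ℝ, E) x x) =
        (mvfderiv 𝓘(ℝ, E) (vectorInChart x W) x : E →L[ℝ] E) := by
    intro W hW
    have h12 : HasFDerivAt (𝕜 := ℝ) (E := E) (F := E)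
      (vectorInChart x W ∘ (extChartAt 𝓘(ℝ, E) x).symm)
      (mvfderiv 𝓘(ℝ, E) (vectorInChart x W) x : E →L[ℝ] E) (extChartAt 𝓘(ℝ, E) x x) :=
      hasFDerivAt_inChart (mdifferentiableAt_vectorInChart hW)
    exact HasFDerivAt.unique (𝕜 := ℝ) (E := E) (F := E)
      (DifferentiableAt.hasFDerivAt (𝕜 := ℝ) (E := E) (F := E) ⟨_, h12⟩) h12
  rw [h7, VectorField.lieBracket, h9, h9, hd Y hY, hd Z hZ]
  have h10 : (tangentCoord E x).symm (h.christoffel x (tangentCoord E x (Y x)) (tangentCoord E x (Z x)))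
    = (tangentCoord E x).symm (h.christoffel x (tangentCoord E x (Z x)) (tangentCoord E x (Y x))) := by
    rw [hc]
  rw [map_sub, leviCivita_apply, leviCivita_apply, map_add, map_add, h10]
  exact add_sub_add_right_eq_sub _ _ _

/-- The Levi-Civita connection is compatible with the metric. -/
theorem leviCivita_metric (Y Z : ∀ y : M, TangentSpace 𝓘(ℝ, E) y) (x : M)
    (hY : MDiffAt (T% Y) x) (hZ : MDiffAt (T% Z) x) (u : TangentSpace 𝓘(ℝ, E) x) :
    mvfderiv 𝓘(ℝ, E) (fun y ↦ h.val y (Y y) (Z y)) x u =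
      h.val x (h.leviCivita Y x u) (Z x) + h.val x (Y x) (h.leviCivita Z x u) := by
  have h0 : (fun y ↦ h.val y (Y y) (Z y)) =ᶠ[nhds x]
      fun y ↦ h.inChart x y (vectorInChart x Y y) (vectorInChart x Z y) := by
    filter_upwards [(trivializationAt E (TangentSpace 𝓘(ℝ, E) : M → Type _) x).open_baseSet.mem_nhds
      (FiberBundle.mem_baseSet_trivializationAt' x)] with y hy
    rw [h.inChart_apply hy]
    have h1 : ∀ W : ∀ y : M, TangentSpace 𝓘(ℝ, E) y,
        (trivializationAt E (TangentSpace 𝓘(ℝ, E) : M → Type _) x).symmL ℝ y (vectorInChart x W y)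
          = W y := by
      intro W
      have := (trivializationAt E (TangentSpace 𝓘(ℝ, E) : M → Type _) x).symmL_continuousLinearMapAt
        (R := ℝ) hy (W y)
      rwa [Trivialization.continuousLinearMapAt_apply, Trivialization.linearMapAt_apply,
        if_pos hy] at this
    rw [h1, h1]
  have e1 := mdifferentiableAt_vectorInChart hY
  have e2 := mdifferentiableAt_vectorInChart hZ
  have e3 := h.mdifferentiableAt_inChart x
  have h2 := hasFDerivAt_inChart' ((e3.clm_apply e1).clm_apply e2)
    (((hasFDerivAt_inChart e3).clm_apply (hasFDerivAt_inChart e1)).clm_apply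
      (hasFDerivAt_inChart e2))
  have h3 := congrArg (fun f : E →L[ℝ] ℝ ↦ f u) h2
  have hp : (extChartAt 𝓘(ℝ, E) x).symm (extChartAt 𝓘(ℝ, E) x x) = x := extChartAt_to_inv x
  rw [mvfderiv_congr h0]
  refine h3.trans ?_
  simp only [Function.comp_apply, hp]
  have r1 : h.val x (h.leviCivita Y x u) (Z x) =
      h.inChart x x (mvfderiv 𝓘(ℝ, E) (vectorInChart x Y) x u) (tangentCoord E x (Z x)) +
        h.christoffelFirst x (tangentCoord E x u) (tangentCoord E x (Y x))
          (tangentCoord E x (Z x)) := by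
    rw [← inChart_christoffel, ← add_apply, ← map_add, inChart_self, leviCivita_apply,
      ContinuousLinearEquiv.symm_apply_apply]
  have r2 : h.val x (Y x) (h.leviCivita Z x u) =
      h.inChart x x (tangentCoord E x (Y x)) (mvfderiv 𝓘(ℝ, E) (vectorInChart x Z) x u) +
        h.christoffelFirst x (tangentCoord E x u) (tangentCoord E x (Z x))
          (tangentCoord E x (Y x)) := by
    rw [← inChart_christoffel,
      h.inChart_symm (FiberBundle.mem_baseSet_trivializationAt' x) (h.christoffel _ _ _),
      ← map_add, inChart_self, leviCivita_apply, ContinuousLinearEquiv.symm_apply_apply]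
  have r3 : h.christoffelFirst x (tangentCoord E x u) (tangentCoord E x (Y x))
        (tangentCoord E x (Z x)) + h.christoffelFirst x (tangentCoord E x u)
          (tangentCoord E x (Z x)) (tangentCoord E x (Y x)) =
      mvfderiv 𝓘(ℝ, E) (h.inChart x) x u (vectorInChart x Y x) (vectorInChart x Z x) := by
    have r4 : h.derivInChart x (tangentCoord E x u) (tangentCoord E x (Y x))
        (tangentCoord E x (Z x)) =
      mvfderiv 𝓘(ℝ, E) (h.inChart x) x u (vectorInChart x Y x) (vectorInChart x Z x) := by
      rw [derivInChart, ContinuousLinearEquiv.symm_apply_apply]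
      rfl
    rw [← r4, christoffelFirst_apply, christoffelFirst_apply,
      h.derivInChart_symm x (tangentCoord E x u) (tangentCoord E x (Z x))]
    ring
  rw [r1, r2, add_add_add_comm, r3]
  change h.inChart x x (vectorInChart x Y x) (mvfderiv 𝓘(ℝ, E) (vectorInChart x Z) x u) +
    (h.inChart x x (mvfderiv 𝓘(ℝ, E) (vectorInChart x Y) x u) (vectorInChart x Z x) +
      mvfderiv 𝓘(ℝ, E) (h.inChart x) x u (vectorInChart x Y x) (vectorInChart x Z x)) = _
  rw [← add_assoc]
  congr 1
  exact add_comm _ _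

end SemiRiemannianMetric

section Endo
variable (h : SemiRiemannianMetric E M) (P : AlmostProductStructure E M)

theorem AlmostProductStructure.mdifferentiableAt_apply {x : M}
    {Y : ∀ y : M, TangentSpace 𝓘(ℝ, E) y} (hY : MDiffAt (T% Y) x) :
    MDiffAt (T% (fun y ↦ P.val y (Y y))) x := by
  have := (P.contMDiff.mdifferentiable (by simp) x).clm_bundle_apply hY
  exact this

variable [FiniteDimensional ℝ E]

theorem tensorialAt_covDeriv (x : M) :
    TensorialAt 𝓘(ℝ, E) E (fun Y : ∀ y : M, TangentSpace 𝓘(ℝ, E) y ↦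
      h.leviCivita (fun y ↦ P.val y (Y y)) x - P.val x ∘L h.leviCivita Y x) x where
  smul {f Y} hf hY := by
    have e : (fun y ↦ P.val y ((f • Y) y)) = f • (fun y ↦ P.val y (Y y)) := by
      ext y; simp
    rw [e, h.leviCivita.isCovariantDerivativeOnUniv.leibniz hY hf,
      h.leviCivita.isCovariantDerivativeOnUniv.leibniz (P.mdifferentiableAt_apply hY) hf]
    ext u
    simp [smul_sub]
  add {Y Z} hY hZ := by
    have e : (fun y ↦ P.val y ((Y + Z) y)) = (fun y ↦ P.val y (Y y)) + (fun y ↦ P.val y (Z y)) := by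
      ext y; simp
    rw [e, h.leviCivita.isCovariantDerivativeOnUniv.add hY hZ,
      h.leviCivita.isCovariantDerivativeOnUniv.add (P.mdifferentiableAt_apply hY)
        (P.mdifferentiableAt_apply hZ)]
    ext u
    simp
    abel

/-- The covariant derivative of `P`: `covDerivEndo h P x u v = (∇_u P) v`, that is
`∇_u (P Y) - P (∇_u Y)` for any vector field `Y` through `v`. -/
def covDerivEndo (x : M) (u v : TangentSpace 𝓘(ℝ, E) x) : TangentSpace 𝓘(ℝ, E) x :=
  TensorialAt.mkHom (V := (TangentSpace 𝓘(ℝ, E) : M → Type _)) _ x (tensorialAt_covDeriv h P x) v u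

theorem covDerivEndo_apply {x : M} {Y : ∀ y : M, TangentSpace 𝓘(ℝ, E) y} (hY : MDiffAt (T% Y) x)
    (u : TangentSpace 𝓘(ℝ, E) x) : covDerivEndo h P x u (Y x) =
      h.leviCivita (fun y ↦ P.val y (Y y)) x u - P.val x (h.leviCivita Y x u) := by
  rw [covDerivEndo, TensorialAt.mkHom_apply _ hY]
  rfl

end Endo

theorem sum_matrix_congr {ι V : Type*} [Fintype ι] [AddCommGroup V] [Module ℝ V]
    (A H : Matrix ι ι ℝ) (B : ι → ι → V) :
    ∑ i, ∑ j, H i j • ∑ k, ∑ l, (A k i * A l j) • B k l =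
      ∑ k, ∑ l, (A * H * A.transpose) k l • B k l := by
  have e1 : ∀ k l, (A * H * A.transpose) k l • B k l =
      ∑ i, ∑ j, (H i j * (A k i * A l j)) • B k l := by
    intro k l
    rw [Finset.sum_comm]
    simp only [Matrix.mul_apply, Matrix.transpose_apply, ← Finset.sum_smul, Finset.sum_mul]
    congr 1
    exact Finset.sum_congr rfl fun j _ ↦ Finset.sum_congr rfl fun i _ ↦ by ring
  simp only [e1, Finset.smul_sum, smul_smul]
  rw [Finset.sum_comm' (t' := Finset.univ) (s' := fun _ ↦ Finset.univ) (by simp)]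
  calc _ = ∑ j, ∑ i, ∑ k, ∑ l, (H i j * (A k i * A l j)) • B k l := rfl
    _ = ∑ i, ∑ k, ∑ j, ∑ l, (H i j * (A k i * A l j)) • B k l := by
      rw [Finset.sum_comm]
      exact Finset.sum_congr rfl fun i _ ↦ Finset.sum_comm
    _ = ∑ k, ∑ i, ∑ l, ∑ j, (H i j * (A k i * A l j)) • B k l := by
      rw [Finset.sum_comm]
      exact Finset.sum_congr rfl fun i _ ↦ Finset.sum_congr rfl fun i _ ↦ Finset.sum_comm
    _ = _ := Finset.sum_congr rfl fun i _ ↦ Finset.sum_comm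

theorem sum_gram_inv_eq {T V : Type*} [AddCommGroup T] [Module ℝ T] [AddCommGroup V] [Module ℝ V]
   (D : Submodule ℝ T) [FiniteDimensional ℝ D] (h : T →ₗ[ℝ] T →ₗ[ℝ] ℝ)
    (B : T →ₗ[ℝ] T →ₗ[ℝ] V) {ι : Type*} [Fintype ι]
    [DecidableEq ι] (b : Module.Basis ι ℝ D) :
    ∑ i, ∑ j, (Matrix.of fun i j ↦ h (Module.finBasis ℝ D i) (Module.finBasis ℝ D j))⁻¹ i j • B (Module.finBasis ℝ D i) (Module.finBasis ℝ D j) =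
      ∑ i, ∑ j, (Matrix.of fun i j ↦ h (b i) (b j))⁻¹ i j • B (b i) (b j) := by
  let e := Module.finBasis ℝ D
  let σ := e.indexEquiv b
  let e' := e.reindex σ
  let A : Matrix ι ι ℝ := e'.toMatrix b
  have hA : IsUnit A.det := by
    have := e'.invertibleToMatrix b
    exact (Matrix.isUnit_iff_isUnit_det A).1 (isUnit_of_invertible A)
  have hb : ∀ j, (b j : T) = ∑ i, A i j • (e' i : T) := by
    intro j
    have := congrArg (Subtype.val) (e'.sum_toMatrix_smul_self b j)
    rw [← this]
    simp only [AddSubmonoidClass.coe_finsetSum, SetLike.val_smul, A]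
  have hbb : ∀ i j, B (b i) (b j) = ∑ k, ∑ l, (A k i * A l j) • B (e' k) (e' l) := by
    intro i j
    simp only [hb, map_sum, map_smul, LinearMap.sum_apply, LinearMap.smul_apply, Finset.smul_sum,
      smul_smul]
    rw [Finset.sum_comm]
    exact Finset.sum_congr rfl fun i _ ↦ Finset.sum_congr rfl fun i _ ↦ by rw [mul_comm]
  have hbh : ∀ i j, h (b i) (b j) = ∑ k, ∑ l, (A k i * A l j) • h (e' k) (e' l) := by
    intro i j
    simp only [hb, map_sum, map_smul, LinearMap.sum_apply, LinearMap.smul_apply, Finset.smul_sum,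
      smul_smul]
    rw [Finset.sum_comm]
    exact Finset.sum_congr rfl fun i _ ↦ Finset.sum_congr rfl fun i _ ↦ by rw [mul_comm]
  let G : Matrix ι ι ℝ := Matrix.of fun i j ↦ h (e' i) (e' j)
  have hGb : (Matrix.of fun i j ↦ h (b i) (b j)) = A.transpose * G * A := by
    ext i j
    simp only [Matrix.of_apply, hbh, Matrix.mul_apply, Matrix.transpose_apply, G,
      Finset.sum_mul, smul_eq_mul]
    rw [Finset.sum_comm]
    exact Finset.sum_congr rfl fun i _ ↦ Finset.sum_congr rfl fun i _ ↦ by ring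
  have h1 : ∑ i, ∑ j, (Matrix.of fun i j ↦ h (e i) (e j))⁻¹ i j • B (e i) (e j) =
      ∑ i, ∑ j, G⁻¹ i j • B (e' i) (e' j) := by
    have h2 : G⁻¹ = ((Matrix.of fun i j ↦ h (e i) (e j))⁻¹).submatrix σ.symm σ.symm := by
      rw [← Matrix.inv_submatrix_equiv]
      congr 1
      ext i j
      simp [G, e']
    rw [h2, ← Equiv.sum_comp σ]
    refine Finset.sum_congr rfl fun i _ ↦ ?_
    rw [← Equiv.sum_comp σ]
    refine Finset.sum_congr rfl fun j _ ↦ ?_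
    simp [e']
  rw [h1, hGb]
  simp only [hbb]
  rw [sum_matrix_congr A _ fun k l ↦ B (e' k) (e' l), Matrix.mul_inv_rev, Matrix.mul_inv_rev,
    ← Matrix.mul_assoc, Matrix.mul_nonsing_inv A hA, Matrix.one_mul, Matrix.mul_assoc,
    Matrix.nonsing_inv_mul A.transpose (by rwa [Matrix.det_transpose]), Matrix.mul_one]

section Trace
variable [FiniteDimensional ℝ E]

/-- The trace `∑ i j, h^{ij} B(e_i, e_j)` of a bilinear map `B` over a subspace `D` of the tangent
space, where `e` is a basis of `D` and `(h^{ij})` is the inverse of the matrix `(h(e_i, e_j))`.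
The choice of the basis is irrelevant, see `metricTrace_eq`. -/
def metricTrace (h : SemiRiemannianMetric E M) (x : M) (D : Submodule ℝ (TangentSpace 𝓘(ℝ, E) x))
    {V : Type*} [AddCommGroup V] [Module ℝ V]
    (B : TangentSpace 𝓘(ℝ, E) x → TangentSpace 𝓘(ℝ, E) x → V) : V :=
  haveI : FiniteDimensional ℝ (TangentSpace 𝓘(ℝ, E) x) := inferInstanceAs (FiniteDimensional ℝ E)
  let e := Module.finBasis ℝ D
  ∑ i, ∑ j, (Matrix.of fun i j ↦ h.val x (e i) (e j))⁻¹ i j • B (e i) (e j)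

/-- The `h`-trace over `D` can be computed in any basis of `D`. -/
theorem metricTrace_eq (h : SemiRiemannianMetric E M) (x : M)
    (D : Submodule ℝ (TangentSpace 𝓘(ℝ, E) x)) {V : Type*} [AddCommGroup V] [Module ℝ V]
    (B : TangentSpace 𝓘(ℝ, E) x →ₗ[ℝ] TangentSpace 𝓘(ℝ, E) x →ₗ[ℝ] V) {ι : Type*} [Fintype ι]
    [DecidableEq ι] (b : Module.Basis ι ℝ D) :
    metricTrace h x D (fun u v ↦ B u v) =
      ∑ i, ∑ j, (Matrix.of fun i j ↦ h.val x (b i) (b j))⁻¹ i j • B (b i) (b j) := by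
  have : FiniteDimensional ℝ (TangentSpace 𝓘(ℝ, E) x) := inferInstanceAs (FiniteDimensional ℝ E)
  exact sum_gram_inv_eq D (LinearMap.mk₂ ℝ (fun u v ↦ h.val x u v) (by simp) (by simp) (by simp)
    (by simp)) B b

end Trace
end Connection

section Maps
variable {E : Type*} [NormedAddCommGroup E] [NormedSpace ℝ E] [FiniteDimensional ℝ E]
  {M : Type*} [TopologicalSpace M] [ChartedSpace E M] [IsManifold 𝓘(ℝ, E) ∞ M]
  {E' : Type*} [NormedAddCommGroup E'] [NormedSpace ℝ E'] [FiniteDimensional ℝ E']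
  {N : Type*} [TopologicalSpace N] [ChartedSpace E' N] [IsManifold 𝓘(ℝ, E') ∞ N]
  (h : SemiRiemannianMetric E M) (g : SemiRiemannianMetric E' N)

/-- Components of a vector field `W` along `F` in the preferred chart of `N` at `F x`. -/
def vectorAlongInChart (F : M → N) (x : M) (W : ∀ y : M, TangentSpace 𝓘(ℝ, E') (F y)) (y : M) :
    E' :=
  (trivializationAt E' (TangentSpace 𝓘(ℝ, E') : N → Type _) (F x) ⟨F y, W y⟩).2

/-- The pullback of the Levi-Civita connection of `g` along `F`, acting on vector fields `W` along `F`: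
`∇_u W = dW(u) + Γ(dF u, W)` in the preferred chart of `N` at `F x`. -/
def covDerivAlong (F : M → N) (W : ∀ y : M, TangentSpace 𝓘(ℝ, E') (F y)) (x : M) :
    TangentSpace 𝓘(ℝ, E) x →L[ℝ] TangentSpace 𝓘(ℝ, E') (F x) :=
  ((tangentCoord E' (F x)).symm : E' →L[ℝ] TangentSpace 𝓘(ℝ, E') (F x)) ∘L
    (mvfderiv 𝓘(ℝ, E) (vectorAlongInChart F x W) x +
      (g.christoffel (F x)).flip (tangentCoord E' (F x) (W x)) ∘L
        (tangentCoord E' (F x) : TangentSpace 𝓘(ℝ, E') (F x) →L[ℝ] E') ∘L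
          mfderiv 𝓘(ℝ, E) 𝓘(ℝ, E') F x)

/-- For the restriction to `F` of a vector field `Z` of `N`: `∇_u (Z ∘ F) = ∇_{dF u} Z`. -/
theorem covDerivAlong_comp {F : M → N} {x : M} (hF : MDiffAt F x)
    {Z : ∀ y : N, TangentSpace 𝓘(ℝ, E') y} (hZ : MDiffAt (T% Z) (F x))
    (u : TangentSpace 𝓘(ℝ, E) x) :
    covDerivAlong (E := E) g F (fun y ↦ Z (F y)) x u =
      g.leviCivita Z (F x) (mfderiv 𝓘(ℝ, E) 𝓘(ℝ, E') F x u) := by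
  have h1 : mvfderiv 𝓘(ℝ, E) (vectorAlongInChart F x fun y ↦ Z (F y)) x u =
      mvfderiv 𝓘(ℝ, E') (vectorInChart (F x) Z) (F x) (mfderiv 𝓘(ℝ, E) 𝓘(ℝ, E') F x u) :=
    congrArg (fun f : TangentSpace 𝓘(ℝ, E) x →L[ℝ] E' ↦ f u)
      (mfderiv_comp x (mdifferentiableAt_vectorInChart hZ) hF)
  rw [SemiRiemannianMetric.leviCivita_apply, ← h1]
  rfl

variable (F : C^∞⟮𝓘(ℝ, E), M; 𝓘(ℝ, E'), N⟯)

/-- The vector field `dF(Y)` along `F`. -/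
def pushforward (Y : ∀ y : M, TangentSpace 𝓘(ℝ, E) y) (y : M) : TangentSpace 𝓘(ℝ, E') (F y) :=
  mfderiv 𝓘(ℝ, E) 𝓘(ℝ, E') F y (Y y)

theorem mdifferentiableAt_pushforward {x : M} {Y : ∀ y : M, TangentSpace 𝓘(ℝ, E) y}
    (hY : MDiffAt (T% Y) x) : MDiffAt (vectorAlongInChart F x (pushforward F Y)) x := by
  have h1 : MDifferentiable 𝓘(ℝ, E).tangent 𝓘(ℝ, E').tangent (tangentMap 𝓘(ℝ, E) 𝓘(ℝ, E') F) :=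
    (F.contMDiff.contMDiff_tangentMap (m := 1) (WithTop.coe_le_coe.2 le_top)).mdifferentiable one_ne_zero
  have h2 : MDifferentiableAt 𝓘(ℝ, E) 𝓘(ℝ, E').tangent
      (fun y ↦ (⟨F y, pushforward F Y y⟩ : TangentBundle 𝓘(ℝ, E') N)) x :=
    (h1 _).comp x hY
  exact ((mdifferentiableAt_totalSpace _ _).1 h2).2

theorem tensorialAt_secondFundamentalForm (x : M) :
    TensorialAt 𝓘(ℝ, E) E (fun Y : ∀ y : M, TangentSpace 𝓘(ℝ, E) y ↦
      covDerivAlong g F (pushforward F Y) x - mfderiv 𝓘(ℝ, E) 𝓘(ℝ, E') F x ∘L h.leviCivita Y x)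
      x where
  smul {f Y} hf hY := by
    have hs : vectorAlongInChart F x (pushforward F (f • Y)) =ᶠ[nhds x]
        f • vectorAlongInChart F x (pushforward F Y) := by
      filter_upwards [F.contMDiff.continuous.continuousAt.preimage_mem_nhds
        ((trivializationAt E' (TangentSpace 𝓘(ℝ, E') : N → Type _) (F x)).open_baseSet.mem_nhds
        (FiberBundle.mem_baseSet_trivializationAt' (F x)))] with y hy
      have := ((trivializationAt E' (TangentSpace 𝓘(ℝ, E') : N → Type _) (F x)).linear ℝ hy).map_smul
        (f y) (pushforward F Y y)
      have e3 : pushforward F (f • Y) y = f y • pushforward F Y y :=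
        map_smul (mfderiv 𝓘(ℝ, E) 𝓘(ℝ, E') F y) (f y) (Y y)
      simp only [vectorAlongInChart, e3]
      exact this
    have e : mvfderiv 𝓘(ℝ, E) (vectorAlongInChart F x (pushforward F (f • Y))) x =
          mvfderiv 𝓘(ℝ, E) (f • vectorAlongInChart F x (pushforward F Y)) x :=
      mvfderiv_congr hs
    have e2 : vectorAlongInChart F x (pushforward F Y) x =
      tangentCoord E' (F x) (mfderiv 𝓘(ℝ, E) 𝓘(ℝ, E') F x (Y x)) := rfl
    rw [h.leviCivita.isCovariantDerivativeOnUniv.leibniz hY hf, covDerivAlong, covDerivAlong, e,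
      mvfderiv_smul hf (mdifferentiableAt_pushforward F hY)]
    ext u
    simp [e2, pushforward, smul_sub]
    abel
  add {Y Z} hY hZ := by
    have hs : vectorAlongInChart F x (pushforward F (Y + Z)) =ᶠ[nhds x]
        vectorAlongInChart F x (pushforward F Y) + vectorAlongInChart F x (pushforward F Z) := by
      filter_upwards [F.contMDiff.continuous.continuousAt.preimage_mem_nhds
        ((trivializationAt E' (TangentSpace 𝓘(ℝ, E') : N → Type _) (F x)).open_baseSet.mem_nhds
        (FiberBundle.mem_baseSet_trivializationAt' (F x)))] with y hy
      have := ((trivializationAt E' (TangentSpace 𝓘(ℝ, E') : N → Type _) (F x)).linear ℝ hy).map_add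
        (pushforward F Y y) (pushforward F Z y)
      have e3 : pushforward F (Y + Z) y = pushforward F Y y + pushforward F Z y :=
        map_add (mfderiv 𝓘(ℝ, E) 𝓘(ℝ, E') F y) (Y y) (Z y)
      simp only [vectorAlongInChart, e3]
      exact this
    have e : mvfderiv 𝓘(ℝ, E) (vectorAlongInChart F x (pushforward F (Y + Z))) x =
          mvfderiv 𝓘(ℝ, E) (vectorAlongInChart F x (pushforward F Y) +
            vectorAlongInChart F x (pushforward F Z)) x :=
      mvfderiv_congr hs
    rw [h.leviCivita.isCovariantDerivativeOnUniv.add hY hZ, covDerivAlong, covDerivAlong,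
      covDerivAlong, e,
      mvfderiv_add (mdifferentiableAt_pushforward F hY) (mdifferentiableAt_pushforward F hZ)]
    ext u
    simp [pushforward]
    abel

/-- The second fundamental form `(∇dF)(u, v) = ∇_u (dF Y) - dF (∇_u Y)`, for any vector field `Y`
through `v`. -/
def secondFundamentalForm (x : M) (u v : TangentSpace 𝓘(ℝ, E) x) : TangentSpace 𝓘(ℝ, E') (F x) :=
  TensorialAt.mkHom (V := (TangentSpace 𝓘(ℝ, E) : M → Type _)) _ x
    (tensorialAt_secondFundamentalForm h g F x) v u

theorem secondFundamentalForm_apply {x : M} {Y : ∀ y : M, TangentSpace 𝓘(ℝ, E) y}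
    (hY : MDiffAt (T% Y) x) (u : TangentSpace 𝓘(ℝ, E) x) :
    secondFundamentalForm h g F x u (Y x) =
      covDerivAlong g F (pushforward F Y) x u -
        mfderiv 𝓘(ℝ, E) 𝓘(ℝ, E') F x (h.leviCivita Y x u) := by
  rw [secondFundamentalForm, TensorialAt.mkHom_apply _ hY]
  rfl

/-- The tension field of `F` along a distribution `D`: the `h`-trace over `D` of the second
fundamental form. -/
def tensionField (D : ∀ x : M, Submodule ℝ (TangentSpace 𝓘(ℝ, E) x)) (x : M) :
    TangentSpace 𝓘(ℝ, E') (F x) :=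
  metricTrace h x (D x) (secondFundamentalForm h g F x)

/-- `F` is `D`-harmonic: its tension field along `D` vanishes. -/
def IsHarmonicAlong (D : ∀ x : M, Submodule ℝ (TangentSpace 𝓘(ℝ, E) x)) : Prop :=
  ∀ x, tensionField h g F D x = 0

/-- `F` is harmonic: its tension field along the whole tangent bundle vanishes. -/
def IsHarmonic : Prop := IsHarmonicAlong h g F (fun _ ↦ ⊤)

end Maps

section Structures
variable {E : Type*} [NormedAddCommGroup E] [NormedSpace ℝ E]
  {M : Type*} [TopologicalSpace M] [ChartedSpace E M] [IsManifold 𝓘(ℝ, E) ∞ M]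
  {E' : Type*} [NormedAddCommGroup E'] [NormedSpace ℝ E']
  {N : Type*} [TopologicalSpace N] [ChartedSpace E' N] [IsManifold 𝓘(ℝ, E') ∞ N]

/-- The metric is Riemannian, i.e. positive definite. -/
def SemiRiemannianMetric.IsRiemannian (h : SemiRiemannianMetric E M) : Prop :=
  ∀ (x : M) (u : TangentSpace 𝓘(ℝ, E) x), u ≠ 0 → 0 < h.val x u u

/-- The metric is pure with respect to `P`: `h(P u, v) = h(u, P v)`. -/
def IsPure (h : SemiRiemannianMetric E M) (P : AlmostProductStructure E M) : Prop :=
  ∀ (x : M) (u v : TangentSpace 𝓘(ℝ, E) x), h.val x (P.val x u) v = h.val x u (P.val x v)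

/-- The metric is hyperbolic with respect to `P`: `h(P u, v) = -h(u, P v)`. -/
def IsHyperbolic (h : SemiRiemannianMetric E M) (P : AlmostProductStructure E M) : Prop :=
  ∀ (x : M) (u v : TangentSpace 𝓘(ℝ, E) x), h.val x (P.val x u) v = -h.val x u (P.val x v)

/-- `(M, h, P)` is an almost product Riemannian manifold. -/
def IsAlmostProductRiemannian (h : SemiRiemannianMetric E M) (P : AlmostProductStructure E M) :
    Prop :=
  h.IsRiemannian ∧ IsPure h P

/-- `(M, h, P)` is an almost para-Hermitian manifold. -/
def IsAlmostParaHermitian (h : SemiRiemannianMetric E M) (P : AlmostProductStructure E M) : Prop :=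
  IsHyperbolic h P

/-- The divergence of `P`: the `h`-trace of `(u, v) ↦ (∇_u P) v`. -/
def divergence [FiniteDimensional ℝ E] (h : SemiRiemannianMetric E M)
    (P : AlmostProductStructure E M) (x : M) : TangentSpace 𝓘(ℝ, E) x :=
  metricTrace h x ⊤ (covDerivEndo h P x)

/-- `(M, h, P)` is a semi decomposable product Riemannian manifold. -/
def IsSemiDecomposable [FiniteDimensional ℝ E] (h : SemiRiemannianMetric E M)
    (P : AlmostProductStructure E M) : Prop :=
  IsAlmostProductRiemannian h P ∧ ∀ x, divergence h P x = 0

/-- The eigendistribution of `P` for the eigenvalue `c`. -/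
def eigendistribution (P : AlmostProductStructure E M) (c : ℝ) (x : M) :
    Submodule ℝ (TangentSpace 𝓘(ℝ, E) x) :=
  Module.End.eigenspace (P.val x : TangentSpace 𝓘(ℝ, E) x →ₗ[ℝ] TangentSpace 𝓘(ℝ, E) x) c

/-- The distribution `D` is Vidal: `∇_X X` is a section of `D` for every smooth section `X`
of `D`. -/
def IsVidal [FiniteDimensional ℝ E] (h : SemiRiemannianMetric E M)
    (D : ∀ x : M, Submodule ℝ (TangentSpace 𝓘(ℝ, E) x)) : Prop :=
  ∀ X : ∀ x : M, TangentSpace 𝓘(ℝ, E) x, CMDiff ∞ (T% X) → (∀ x, X x ∈ D x) →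
    ∀ x, h.leviCivita X x (X x) ∈ D x

/-- `F` is `(P, Q)`-paraholomorphic: `dF ∘ P = Q ∘ dF`. -/
def IsParaholomorphic (P : AlmostProductStructure E M) (Q : AlmostProductStructure E' N)
    (F : C^∞⟮𝓘(ℝ, E), M; 𝓘(ℝ, E'), N⟯) : Prop :=
  ∀ (x : M) (u : TangentSpace 𝓘(ℝ, E) x),
    mfderiv 𝓘(ℝ, E) 𝓘(ℝ, E') F x (P.val x u) = Q.val (F x) (mfderiv 𝓘(ℝ, E) 𝓘(ℝ, E') F x u)

/-- `F` is `-(P, Q)`-paraholomorphic: `dF ∘ P = -Q ∘ dF`. -/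
def IsAntiParaholomorphic (P : AlmostProductStructure E M) (Q : AlmostProductStructure E' N)
    (F : C^∞⟮𝓘(ℝ, E), M; 𝓘(ℝ, E'), N⟯) : Prop :=
  ∀ (x : M) (u : TangentSpace 𝓘(ℝ, E) x),
    mfderiv 𝓘(ℝ, E) 𝓘(ℝ, E') F x (P.val x u) = -Q.val (F x) (mfderiv 𝓘(ℝ, E) 𝓘(ℝ, E') F x u)

variable [FiniteDimensional ℝ E] [FiniteDimensional ℝ E']

/-- `F` is plus-eigen harmonic: harmonic along the eigendistribution of `P` for `1`. -/
def IsPlusEigenHarmonic (h : SemiRiemannianMetric E M) (P : AlmostProductStructure E M)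
    (g : SemiRiemannianMetric E' N) (F : C^∞⟮𝓘(ℝ, E), M; 𝓘(ℝ, E'), N⟯) : Prop :=
  IsHarmonicAlong h g F (eigendistribution P 1)

/-- `F` is minus-eigen harmonic: harmonic along the eigendistribution of `P` for `-1`. -/
def IsMinusEigenHarmonic (h : SemiRiemannianMetric E M) (P : AlmostProductStructure E M)
    (g : SemiRiemannianMetric E' N) (F : C^∞⟮𝓘(ℝ, E), M; 𝓘(ℝ, E'), N⟯) : Prop :=
  IsHarmonicAlong h g F (eigendistribution P (-1))

end Structures

end

/-! Write `S` for the second fundamental form of `F` and `T_c` for the tension field along the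
`c`-eigendistribution of `P`, `c = ±1`. By pointwise orthogonality of the two eigendistributions,
the full tension field is `T_1 + T_{-1}`, so only the passage from harmonic to eigen harmonic has
content. The idea is that `T_1` and `T_{-1}` lie in complementary eigenspaces of `Q`; a vanishing
sum then forces both to vanish.

Differentiating `dF ∘ P = Q ∘ dF` gives `S(u, Pv) + dF((∇_u P)v) = (∇_{dF u} Q)(dF v) + Q S(u, v)`
(`IsParaholomorphic.secondFundamentalForm_apply`). Put `u = v` in the `c`-eigenspace of `P`. Then
`dF u` is in the `c`-eigenspace of `Q`, and the Vidal condition kills the `Q`-derivative term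
(`covDerivEndo_self_of_isVidal`). Hence the bilinear map `c S - Q S + dF ∘ ∇P` is alternating on
that eigenspace and has trace zero, which reads `Q T_c = c T_c + dF(tr_c ∇P)`
(`IsParaholomorphic.apply_tensionField`).

The last term vanishes. Since `∇_u P` anticommutes with `P`, the partial trace `tr_c ∇P` is in the
`(-c)`-eigenspace of `P`. The two partial traces add up to `div P = 0`, so each is zero
(`IsSemiDecomposable.metricTrace_covDerivEndo`), and `Q T_c = c T_c`. The case of a `-(P,
Q)`-paraholomorphic map is the same statement for `-Q`. -/

/-! ### Traces of bilinear maps with respect to a metric -/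

section MetricTrace
variable {E : Type*} [NormedAddCommGroup E] [NormedSpace ℝ E]
  {M : Type*} [TopologicalSpace M] [ChartedSpace E M] [IsManifold 𝓘(ℝ, E) ∞ M]
  (h : SemiRiemannianMetric E M) {x : M} {D : Submodule ℝ (TangentSpace 𝓘(ℝ, E) x)}

theorem SemiRiemannianMetric.IsRiemannian.isUnit_gram (hh : h.IsRiemannian) {ι : Type*} [Fintype ι]
    [DecidableEq ι] (b : Module.Basis ι ℝ D) :
    IsUnit (Matrix.of fun i j ↦ h.val x (b i) (b j)) := by
  rw [← Matrix.mulVec_injective_iff_isUnit]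
  refine (injective_iff_map_eq_zero (Matrix.mulVecLin _)).2 fun c hc ↦ ?_
  -- For `c` in the kernel of the Gram matrix `G`, the vector `v = ∑ c_i b_i` satisfies `h(v, v) =
  -- cᵀ G c = 0`, so `v = 0` by positive definiteness.
  have h1 : (∑ i, c i • b i : D) = 0 := by
    by_contra hne
    have h2 := hh x (∑ i, c i • b i : D) (by rwa [Ne, Submodule.coe_eq_zero])
    have h3 : h.val x ((∑ i, c i • b i : D) : TangentSpace 𝓘(ℝ, E) x)
        ((∑ i, c i • b i : D) : TangentSpace 𝓘(ℝ, E) x) =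
        ∑ i, c i * (Matrix.of fun i j ↦ h.val x (b i) (b j)).mulVec c i := by
      simp only [Submodule.coe_sum, Submodule.coe_smul, map_sum, map_smul, sum_apply, smul_apply,
        Matrix.mulVec, dotProduct, Matrix.of_apply, smul_eq_mul, Finset.mul_sum]
      rw [Finset.sum_comm]
      exact Finset.sum_congr rfl fun i _ ↦ Finset.sum_congr rfl fun j _ ↦ by ring
    rw [Matrix.mulVecLin_apply] at hc
    rw [h3, hc] at h2
    simp at h2
  funext i
  exact Fintype.linearIndependent_iff.1 b.linearIndependent c h1 i

variable [FiniteDimensional ℝ E]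
  {V W : Type*} [AddCommGroup V] [Module ℝ V] [AddCommGroup W] [Module ℝ W]

theorem metricTrace_congr {B B' : TangentSpace 𝓘(ℝ, E) x → TangentSpace 𝓘(ℝ, E) x → V}
    (hB : ∀ u ∈ D, ∀ v ∈ D, B u v = B' u v) : metricTrace h x D B = metricTrace h x D B' :=
  Finset.sum_congr rfl fun _ _ ↦ Finset.sum_congr rfl fun _ _ ↦ by
    rw [hB _ (Subtype.coe_prop _) _ (Subtype.coe_prop _)]

theorem metricTrace_add (B B' : TangentSpace 𝓘(ℝ, E) x → TangentSpace 𝓘(ℝ, E) x → V) :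
    metricTrace h x D (fun u v ↦ B u v + B' u v) =
      metricTrace h x D B + metricTrace h x D B' := by
  simp only [metricTrace, smul_add, Finset.sum_add_distrib]

theorem metricTrace_map (L : V →ₗ[ℝ] W)
    (B : TangentSpace 𝓘(ℝ, E) x → TangentSpace 𝓘(ℝ, E) x → V) :
    metricTrace h x D (fun u v ↦ L (B u v)) = L (metricTrace h x D B) := by
  simp only [metricTrace, map_sum, map_smul]

/-- The trace of an alternating bilinear map vanishes. -/
theorem metricTrace_eq_zero_of_diagonal
    (B : TangentSpace 𝓘(ℝ, E) x →ₗ[ℝ] TangentSpace 𝓘(ℝ, E) x →ₗ[ℝ] V)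
    (hB : ∀ u ∈ D, B u u = 0) : metricTrace h x D (fun u v ↦ B u v) = 0 := by
  have : FiniteDimensional ℝ (TangentSpace 𝓘(ℝ, E) x) := inferInstanceAs (FiniteDimensional ℝ E)
  rw [metricTrace_eq h x D B (Module.finBasis ℝ D)]
  set e := Module.finBasis ℝ D
  set G := Matrix.of fun i j ↦ h.val x (e i) (e j)
  have hskew : ∀ i j, B (e i) (e j) = -B (e j) (e i) := by
    intro i j
    have h1 := hB _ (e i + e j).2
    simp only [Submodule.coe_add, map_add, LinearMap.add_apply, hB _ (e i).2, hB _ (e j).2,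
      zero_add, add_zero] at h1
    rw [eq_neg_iff_add_eq_zero, add_comm]
    exact h1
  have hsymm : ∀ i j, G⁻¹ i j = G⁻¹ j i := by
    intro i j
    have h1 : G.transpose = G := by
      ext i j
      exact h.symm x _ _
    have h2 := Matrix.transpose_nonsing_inv G
    rw [h1] at h2
    exact congrFun (congrFun h2 j) i
  -- A symmetric matrix is contracted with a skew one: exchanging the two indices changes the sign
  -- of the sum.
  have h2 : ∑ i, ∑ j, G⁻¹ i j • B (e i) (e j) = -∑ i, ∑ j, G⁻¹ i j • B (e i) (e j) := by
    conv_lhs => rw [Finset.sum_comm]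
    simp only [← Finset.sum_neg_distrib]
    refine Finset.sum_congr rfl fun i _ ↦ Finset.sum_congr rfl fun j _ ↦ ?_
    rw [hskew, hsymm, smul_neg]
  rw [eq_neg_iff_add_eq_zero, ← two_smul ℝ] at h2
  exact (smul_eq_zero_iff_right two_ne_zero).1 h2

/-- The trace is additive over orthogonal decompositions. -/
theorem metricTrace_top_of_isCompl (hh : h.IsRiemannian)
    {D₁ D₂ : Submodule ℝ (TangentSpace 𝓘(ℝ, E) x)} (hc : IsCompl D₁ D₂)
    (ho : ∀ u ∈ D₁, ∀ v ∈ D₂, h.val x u v = 0)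
    (B : TangentSpace 𝓘(ℝ, E) x →ₗ[ℝ] TangentSpace 𝓘(ℝ, E) x →ₗ[ℝ] V) :
    metricTrace h x ⊤ (fun u v ↦ B u v) =
      metricTrace h x D₁ (fun u v ↦ B u v) + metricTrace h x D₂ (fun u v ↦ B u v) := by
  have : FiniteDimensional ℝ (TangentSpace 𝓘(ℝ, E) x) := inferInstanceAs (FiniteDimensional ℝ E)
  let e₁ := Module.finBasis ℝ D₁
  let e₂ := Module.finBasis ℝ D₂
  -- A basis adapted to the splitting, carried over to the submodule `⊤`, over which the full trace
  -- is taken. In it the Gram matrix is block diagonal.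
  let b := ((e₁.prod e₂).map (Submodule.prodEquivOfIsCompl D₁ D₂ hc)).map
    (LinearEquiv.ofTop (⊤ : Submodule ℝ (TangentSpace 𝓘(ℝ, E) x)) rfl).symm
  have hl : ∀ i, (b (Sum.inl i) : TangentSpace 𝓘(ℝ, E) x) = e₁ i := fun i ↦ by
    simp [b]
  have hr : ∀ i, (b (Sum.inr i) : TangentSpace 𝓘(ℝ, E) x) = e₂ i := fun i ↦ by
    simp [b]
  rw [metricTrace_eq h x _ B b, metricTrace_eq h x _ B e₁, metricTrace_eq h x _ B e₂]
  have hG : (Matrix.of fun i j ↦ h.val x (b i) (b j)) =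
      Matrix.fromBlocks (Matrix.of fun i j ↦ h.val x (e₁ i) (e₁ j)) 0 0
        (Matrix.of fun i j ↦ h.val x (e₂ i) (e₂ j)) := by
    ext i j
    rcases i with i | i <;> rcases j with j | j
    · simp [hl]
    · simp [hl, hr, ho _ (e₁ i).2 _ (e₂ j).2]
    · simp [hl, hr, h.symm x (e₂ i), ho _ (e₁ j).2 _ (e₂ i).2]
    · simp [hr]
  -- Blockwise inversion needs the two blocks to be invertible or singular together; positive
  -- definiteness makes both invertible.
  rw [hG, Matrix.inv_fromBlocks_zero₂₁_of_isUnit_iff _ _ _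
    (iff_of_true (hh.isUnit_gram h e₁) (hh.isUnit_gram h e₂))]
  simp [Fintype.sum_sum_type, hl, hr]

end MetricTrace

/-! ### Eigendistributions of an almost product structure -/

section Eigendistribution
variable {E : Type*} [NormedAddCommGroup E] [NormedSpace ℝ E]
  {M : Type*} [TopologicalSpace M] [ChartedSpace E M] [IsManifold 𝓘(ℝ, E) ∞ M]

theorem mem_eigendistribution (Q : AlmostProductStructure E M) {c : ℝ} {x : M}
    {u : TangentSpace 𝓘(ℝ, E) x} : u ∈ eigendistribution Q c x ↔ Q.val x u = c • u :=
  Module.End.mem_eigenspace_iff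

/-- Turns a `-(P, Q)`-paraholomorphic map into a `(P, -Q)`-paraholomorphic one, at the price of
exchanging the eigendistributions of `Q`. -/
noncomputable instance : Neg (AlmostProductStructure E M) where
  neg P :=
    { val x := -P.val x
      apply_apply x u := by simp [P.apply_apply]
      contMDiff := P.contMDiff.neg_section }

theorem AlmostProductStructure.neg_val (P : AlmostProductStructure E M) (x : M)
    (u : TangentSpace 𝓘(ℝ, E) x) : (-P).val x u = -P.val x u := rfl

theorem eigendistribution_neg (P : AlmostProductStructure E M) (c : ℝ) :
    eigendistribution (-P) c = eigendistribution P (-c) := by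
  funext x
  ext u
  rw [mem_eigendistribution, mem_eigendistribution, P.neg_val, neg_smul, neg_eq_iff_eq_neg]

theorem AlmostProductStructure.contMDiff_apply {Y : ∀ y : M, TangentSpace 𝓘(ℝ, E) y}
    (Q : AlmostProductStructure E M) (hY : CMDiff ∞ (T% Y)) :
    CMDiff ∞ (T% (fun y ↦ Q.val y (Y y))) := by
  have := Q.contMDiff.clm_bundle_apply hY
  exact this

/-- Eigenvectors for `1` and `-1` with vanishing sum vanish. -/
theorem AlmostProductStructure.eq_zero_of_add_eq_zero (P : AlmostProductStructure E M)
    {x : M} {u v : TangentSpace 𝓘(ℝ, E) x}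
    (hu : u ∈ eigendistribution P 1 x) (hv : v ∈ eigendistribution P (-1) x) (huv : u + v = 0) :
    u = 0 ∧ v = 0 := by
  have h0 : u = 0 := by
    rw [mem_eigendistribution] at hu hv
    -- Applying `P` to `u + v = 0` gives `u - v = 0`; with `v = -u` this is `2u = 0`.
    have h1 : P.val x (u + v) = 0 := by rw [huv, map_zero]
    rw [map_add, hu, hv, one_smul, neg_one_smul, eq_neg_of_add_eq_zero_right huv, neg_neg,
      ← two_smul ℝ] at h1
    exact (smul_eq_zero_iff_right two_ne_zero).1 h1
  exact ⟨h0, by rwa [h0, zero_add] at huv⟩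

theorem isCompl_eigendistribution (P : AlmostProductStructure E M) (x : M) :
    IsCompl (eigendistribution P 1 x) (eigendistribution P (-1) x) := by
  constructor
  · rw [Submodule.disjoint_def]
    exact fun u hu hu' ↦ (P.eq_zero_of_add_eq_zero hu (neg_mem hu') (add_neg_cancel u)).1
  · rw [codisjoint_iff, eq_top_iff]
    intro u _
    -- The operators `(1 ± P)/2` are the projections onto the two eigenspaces.
    have hu : u = (2⁻¹ : ℝ) • (u + P.val x u) + (2⁻¹ : ℝ) • (u - P.val x u) := by
      rw [← smul_add, add_add_sub_cancel, ← two_smul ℝ, smul_smul, inv_mul_cancel₀ two_ne_zero,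
        one_smul]
    rw [hu]
    refine Submodule.add_mem_sup (Submodule.smul_mem _ _ ?_) (Submodule.smul_mem _ _ ?_)
    · rw [mem_eigendistribution, map_add, P.apply_apply, one_smul, add_comm]
    · rw [mem_eigendistribution, map_sub, P.apply_apply, neg_one_smul, neg_sub]

/-- A self-adjoint operator has orthogonal eigenspaces for distinct eigenvalues: here `h(u, v) =
h(Pu, v) = h(u, Pv) = -h(u, v)`. -/
theorem IsPure.val_eq_zero {h : SemiRiemannianMetric E M} {P : AlmostProductStructure E M}
    (hP : IsPure h P) {x : M} {u v : TangentSpace 𝓘(ℝ, E) x}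
    (hu : u ∈ eigendistribution P 1 x) (hv : v ∈ eigendistribution P (-1) x) :
    h.val x u v = 0 := by
  have h1 := hP x u v
  rw [mem_eigendistribution] at hu hv
  rw [hu, hv, one_smul, neg_one_smul, map_neg] at h1
  linarith

end Eigendistribution

/-! ### Global extension of tangent vectors and the Vidal condition -/

section Extension
variable {E : Type*} [NormedAddCommGroup E] [NormedSpace ℝ E] [FiniteDimensional ℝ E]
  {M : Type*} [TopologicalSpace M] [T2Space M] [ChartedSpace E M] [IsManifold 𝓘(ℝ, E) ∞ M]

/-- A local smooth extension is cut off by a bump function. Global smoothness matters because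
`IsVidal` quantifies over globally defined smooth sections only. -/
theorem exists_contMDiff_vectorField_eq (x : M) (w : TangentSpace 𝓘(ℝ, E) x) :
    ∃ X : ∀ y : M, TangentSpace 𝓘(ℝ, E) y, CMDiff ∞ (T% X) ∧ X x = w := by
  obtain ⟨s, hs, hX⟩ := FiberBundle.exists_contMDiffOn_extend (k := ∞) 𝓘(ℝ, E) E
    (V := (TangentSpace 𝓘(ℝ, E) : M → Type _)) w
  obtain ⟨f, -, hf⟩ := (SmoothBumpFunction.nhds_basis_tsupport (I := 𝓘(ℝ, E)) x).mem_iff.1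
    (interior_mem_nhds.2 hs)
  refine ⟨(f : M → ℝ) • FiberBundle.extend E w, ContMDiffOn.smul_section_of_tsupport
    f.contMDiff.contMDiffOn isOpen_interior hf (hX.mono interior_subset), ?_⟩
  simp

variable (g : SemiRiemannianMetric E M) (Q : AlmostProductStructure E M)

/-- If the eigendistribution of `Q` for `c = ±1` is Vidal, then `(∇_w Q) w = 0` for `w` in it. -/
theorem covDerivEndo_self_of_isVidal {c : ℝ} (hc : c * c = 1)
    (hQ : IsVidal g (eigendistribution Q c)) {x : M} {w : TangentSpace 𝓘(ℝ, E) x}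
    (hw : w ∈ eigendistribution Q c x) : covDerivEndo g Q x w w = 0 := by
  obtain ⟨Z, hZ, rfl⟩ := exists_contMDiff_vectorField_eq x w
  -- As `c² = 1`, the operator `(1 + cQ)/2` projects onto the `c`-eigendistribution. It makes a
  -- section of that distribution out of `Z` without changing the value at `x`, which is already an
  -- eigenvector.
  let X : ∀ y : M, TangentSpace 𝓘(ℝ, E) y :=
    (2⁻¹ : ℝ) • (Z + c • fun y ↦ Q.val y (Z y))
  have hX : CMDiff ∞ (T% X) :=
    (hZ.add_section (Q.contMDiff_apply hZ).const_smul_section).const_smul_section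
  have hXmem : ∀ y, X y ∈ eigendistribution Q c y := by
    intro y
    rw [mem_eigendistribution]
    simp only [X, Pi.smul_apply, Pi.add_apply, map_smul, map_add, Q.apply_apply, smul_add,
      smul_smul]
    rw [add_comm]
    congr 2
    · ring
    · linear_combination (-2⁻¹ : ℝ) * hc
  have hXx : X x = Z x := by
    simp only [X, Pi.smul_apply, Pi.add_apply, (mem_eigendistribution Q).1 hw, smul_smul, hc]
    rw [one_smul, ← two_smul ℝ, smul_smul, inv_mul_cancel₀ two_ne_zero, one_smul]
  have hXd : MDiffAt (T% X) x := hX.mdifferentiable (by simp) x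
  -- Since `QX = cX` everywhere, `(∇_X Q)X = c ∇_X X - Q ∇_X X`, and this vanishes because `∇_X X`
  -- is again in the `c`-eigendistribution.
  have h1 := covDerivEndo_apply g Q hXd (X x)
  have h2 : (fun y ↦ Q.val y (X y)) = c • X :=
    funext fun y ↦ (mem_eigendistribution Q).1 (hXmem y)
  have h3 : g.leviCivita (c • X) x = c • g.leviCivita X x :=
    g.leviCivita.isCovariantDerivativeOnUniv.smul_const c hXd
  rw [h2, h3, smul_apply, (mem_eigendistribution Q).1 (hQ X hX hXmem x), sub_self, hXx] at h1
  exact h1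

end Extension

/-! ### Product rule for an endomorphism field acting on vector fields along a map -/

section Along
variable {E : Type*} [NormedAddCommGroup E] [NormedSpace ℝ E]
  {M : Type*} [TopologicalSpace M] [ChartedSpace E M] [IsManifold 𝓘(ℝ, E) ∞ M]
  {E' : Type*} [NormedAddCommGroup E'] [NormedSpace ℝ E']
  {N : Type*} [TopologicalSpace N] [ChartedSpace E' N] [IsManifold 𝓘(ℝ, E') ∞ N]

theorem mvfderiv_clm_apply {V W : Type*} [NormedAddCommGroup V] [NormedSpace ℝ V]
    [NormedAddCommGroup W] [NormedSpace ℝ W] {A : M → V →L[ℝ] W} {v : M → V} {x : M}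
    (hA : MDiffAt A x) (hv : MDiffAt v x) (u : TangentSpace 𝓘(ℝ, E) x) :
    mvfderiv 𝓘(ℝ, E) (fun y ↦ A y (v y)) x u =
      mvfderiv 𝓘(ℝ, E) A x u (v x) + A x (mvfderiv 𝓘(ℝ, E) v x u) := by
  have h1 := hasFDerivAt_inChart' (hA.clm_apply hv)
    ((hasFDerivAt_inChart hA).clm_apply (hasFDerivAt_inChart hv))
  have hp : (extChartAt 𝓘(ℝ, E) x).symm (extChartAt 𝓘(ℝ, E) x x) = x := extChartAt_to_inv x
  refine (congrArg (fun f : E →L[ℝ] W ↦ f u) h1).trans ?_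
  simp only [Function.comp_apply, hp]
  exact add_comm _ _

namespace AlmostProductStructure
variable (Q : AlmostProductStructure E' N)

/-- Components of `Q` in the preferred chart at `x`, as a function of the point `y` near `x`. -/
noncomputable def inChart (x y : N) : E' →L[ℝ] E' :=
  (trivializationAt (E' →L[ℝ] E')
    (fun x : N ↦ TangentSpace 𝓘(ℝ, E') x →L[ℝ] TangentSpace 𝓘(ℝ, E') x) x ⟨y, Q.val y⟩).2

theorem mdifferentiableAt_inChart (x : N) : MDiffAt (Q.inChart x) x :=
  (mdifferentiableAt_section _ _).1 (Q.contMDiff.mdifferentiable (by simp) x)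

/-- The trivialization of the endomorphism bundle is conjugation by that of the tangent bundle, so
taking components intertwines `Q` with its coordinate matrix. -/
theorem inChart_apply {x y : N}
    (hy : y ∈ (trivializationAt E' (TangentSpace 𝓘(ℝ, E') : N → Type _) x).baseSet)
    (v : TangentSpace 𝓘(ℝ, E') y) :
    Q.inChart x y (trivializationAt E' (TangentSpace 𝓘(ℝ, E') : N → Type _) x ⟨y, v⟩).2 =
      (trivializationAt E' (TangentSpace 𝓘(ℝ, E') : N → Type _) x ⟨y, Q.val y v⟩).2 := by
  rw [inChart, hom_trivializationAt_apply, ContinuousLinearMap.inCoordinates_eq hy hy]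
  have h1 := ((trivializationAt E' (TangentSpace 𝓘(ℝ, E') : N → Type _) x).continuousLinearEquivAt
    ℝ y hy).symm_apply_apply v
  exact congrArg (fun w : TangentSpace 𝓘(ℝ, E') y ↦
    (trivializationAt E' (TangentSpace 𝓘(ℝ, E') : N → Type _) x ⟨y, Q.val y w⟩).2) h1

theorem inChart_tangentCoord (x : N) (v : TangentSpace 𝓘(ℝ, E') x) :
    Q.inChart x x (tangentCoord E' x v) = tangentCoord E' x (Q.val x v) :=
  Q.inChart_apply (FiberBundle.mem_baseSet_trivializationAt' x) v

end AlmostProductStructure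

variable [FiniteDimensional ℝ E'] (g : SemiRiemannianMetric E' N) (Q : AlmostProductStructure E' N)
  {F : M → N} {x : M}

/-- The derivative of `W` cancels between `∇_u (Q W)` and `Q (∇_u W)`. The point is that the
right-hand side sees `W` only through `W x`, so `W` may be exchanged for any other differentiable
field along `F` with the same value at `x`. -/
theorem covDerivAlong_endo_inChart (hF : MDiffAt F x)
    {W : ∀ y : M, TangentSpace 𝓘(ℝ, E') (F y)} (hW : MDiffAt (vectorAlongInChart F x W) x)
    (u : TangentSpace 𝓘(ℝ, E) x) :
    tangentCoord E' (F x) (covDerivAlong (E := E) g F (fun y ↦ Q.val (F y) (W y)) x u -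
        Q.val (F x) (covDerivAlong (E := E) g F W x u)) =
      mvfderiv 𝓘(ℝ, E) (fun y ↦ Q.inChart (F x) (F y)) x u (tangentCoord E' (F x) (W x)) +
        g.christoffel (F x) (tangentCoord E' (F x) (mfderiv 𝓘(ℝ, E) 𝓘(ℝ, E') F x u))
          (tangentCoord E' (F x) (Q.val (F x) (W x))) -
        Q.inChart (F x) (F x) (g.christoffel (F x)
          (tangentCoord E' (F x) (mfderiv 𝓘(ℝ, E) 𝓘(ℝ, E') F x u))
          (tangentCoord E' (F x) (W x))) := by
  have h1 : vectorAlongInChart F x (fun y ↦ Q.val (F y) (W y)) =ᶠ[nhds x]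
      fun y ↦ Q.inChart (F x) (F y) (vectorAlongInChart F x W y) := by
    filter_upwards [hF.continuousAt.preimage_mem_nhds
      ((trivializationAt E' (TangentSpace 𝓘(ℝ, E') : N → Type _) (F x)).open_baseSet.mem_nhds
      (FiberBundle.mem_baseSet_trivializationAt' (F x)))] with y hy
    exact (Q.inChart_apply hy (W y)).symm
  have h2 : MDiffAt (fun y ↦ Q.inChart (F x) (F y)) x :=
    (Q.mdifferentiableAt_inChart (F x)).comp x hF
  have h3 : vectorAlongInChart F x W x = tangentCoord E' (F x) (W x) := rfl
  have h4 : ∀ V : ∀ y : M, TangentSpace 𝓘(ℝ, E') (F y),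
      tangentCoord E' (F x) (covDerivAlong (E := E) g F V x u) =
      mvfderiv 𝓘(ℝ, E) (vectorAlongInChart F x V) x u +
        g.christoffel (F x) (tangentCoord E' (F x) (mfderiv 𝓘(ℝ, E) 𝓘(ℝ, E') F x u))
          (tangentCoord E' (F x) (V x)) := fun V ↦
    (tangentCoord E' (F x)).apply_symm_apply _
  rw [map_sub, ← Q.inChart_tangentCoord, h4, h4, mvfderiv_congr h1, mvfderiv_clm_apply h2 hW,
    map_add, h3]
  abel

variable [FiniteDimensional ℝ E]

/-- The product rule `∇_u (Q W) = (∇_{dF u} Q) W + Q (∇_u W)` for vector fields `W` along `F`. -/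
theorem covDerivAlong_endo (hF : MDiffAt F x)
    {W : ∀ y : M, TangentSpace 𝓘(ℝ, E') (F y)} (hW : MDiffAt (vectorAlongInChart F x W) x)
    (u : TangentSpace 𝓘(ℝ, E) x) :
    covDerivAlong (E := E) g F (fun y ↦ Q.val (F y) (W y)) x u =
      covDerivEndo g Q (F x) (mfderiv 𝓘(ℝ, E) 𝓘(ℝ, E') F x u) (W x) +
        Q.val (F x) (covDerivAlong (E := E) g F W x u) := by
  -- A general `W` need not come from a field on `N`. Replacing it by `Z ∘ F`, with `Z` extending
  -- the vector `W x`, reduces the claim to the definition of `∇Q` on `N`.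
  let Z : ∀ y : N, TangentSpace 𝓘(ℝ, E') y := FiberBundle.extend E' (W x)
  have hZ : MDiffAt (T% Z) (F x) := FiberBundle.mdifferentiableAt_extend 𝓘(ℝ, E') E' (W x)
  have hZx : Z (F x) = W x := FiberBundle.extend_apply_self ..
  have hZF : MDiffAt (vectorAlongInChart F x fun y ↦ Z (F y)) x :=
    (mdifferentiableAt_vectorInChart hZ).comp x hF
  have h1 := covDerivAlong_endo_inChart g Q hF hZF u
  rw [hZx, ← covDerivAlong_endo_inChart g Q hF hW u] at h1
  have h2 := covDerivAlong_comp g hF (Q.mdifferentiableAt_apply hZ) u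
  have h3 := (tangentCoord E' (F x)).injective h1
  rw [h2, covDerivAlong_comp g hF hZ u, ← covDerivEndo_apply g Q hZ, hZx] at h3
  rw [h3, sub_add_cancel]

end Along

/-! ### Tension fields of paraholomorphic maps -/

section Harmonic
variable {E : Type*} [NormedAddCommGroup E] [NormedSpace ℝ E] [FiniteDimensional ℝ E]
  {M : Type*} [TopologicalSpace M] [ChartedSpace E M] [IsManifold 𝓘(ℝ, E) ∞ M]
  {E' : Type*} [NormedAddCommGroup E'] [NormedSpace ℝ E'] [FiniteDimensional ℝ E']
  {N : Type*} [TopologicalSpace N] [ChartedSpace E' N] [IsManifold 𝓘(ℝ, E') ∞ N]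
  (h : SemiRiemannianMetric E M) (P : AlmostProductStructure E M)
  (g : SemiRiemannianMetric E' N) (Q : AlmostProductStructure E' N)
  (F : C^∞⟮𝓘(ℝ, E), M; 𝓘(ℝ, E'), N⟯)

/-- The covariant derivative `(u, v) ↦ (∇_u P) v` as a bilinear map. -/
noncomputable def covDerivEndoBilin (x : M) :
    TangentSpace 𝓘(ℝ, E) x →ₗ[ℝ] TangentSpace 𝓘(ℝ, E) x →ₗ[ℝ] TangentSpace 𝓘(ℝ, E) x :=
  LinearMap.mk₂ ℝ (covDerivEndo h P x) (by simp [covDerivEndo]) (by simp [covDerivEndo])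
    (by simp [covDerivEndo]) (by simp [covDerivEndo])

/-- The second fundamental form as a bilinear map. -/
noncomputable def secondFundamentalFormBilin (x : M) :
    TangentSpace 𝓘(ℝ, E) x →ₗ[ℝ] TangentSpace 𝓘(ℝ, E) x →ₗ[ℝ] TangentSpace 𝓘(ℝ, E') (F x) :=
  LinearMap.mk₂ ℝ (secondFundamentalForm h g F x) (by simp [secondFundamentalForm])
    (by simp [secondFundamentalForm]) (by simp [secondFundamentalForm])
    (by simp [secondFundamentalForm])

/-- The covariant derivative of `P` anticommutes with `P`. -/
theorem covDerivEndo_apply_apply {x : M} (u v : TangentSpace 𝓘(ℝ, E) x) :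
    covDerivEndo h P x u (P.val x v) = -P.val x (covDerivEndo h P x u v) := by
  have hY := FiberBundle.mdifferentiableAt_extend 𝓘(ℝ, E) E
    (V := (TangentSpace 𝓘(ℝ, E) : M → Type _)) v
  have hv : FiberBundle.extend E (E := (TangentSpace 𝓘(ℝ, E) : M → Type _)) v x = v :=
    FiberBundle.extend_apply_self ..
  have h1 := covDerivEndo_apply h P hY u
  -- Evaluated on the field `PY`, the definition gives `(∇_u P)(PY) = ∇_u Y - P ∇_u (PY)` because
  -- `P² = 1`; this is `-P` applied to `(∇_u P)Y`.
  have h2 := covDerivEndo_apply h P (P.mdifferentiableAt_apply hY) u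
  simp only [P.apply_apply] at h2
  rw [hv] at h1 h2
  rw [h1, h2, map_sub, P.apply_apply, neg_sub]

/-- This is the covariant derivative of `dF ∘ P = Q ∘ dF` in the direction `u`, with the product
rule applied on both sides and evaluated at `v`. -/
theorem IsParaholomorphic.secondFundamentalForm_apply (hF : IsParaholomorphic P Q F) {x : M}
    (u v : TangentSpace 𝓘(ℝ, E) x) :
    secondFundamentalForm h g F x u (P.val x v) +
        mfderiv 𝓘(ℝ, E) 𝓘(ℝ, E') F x (covDerivEndo h P x u v) =
      covDerivEndo g Q (F x) (mfderiv 𝓘(ℝ, E) 𝓘(ℝ, E') F x u)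
        (mfderiv 𝓘(ℝ, E) 𝓘(ℝ, E') F x v) + Q.val (F x) (secondFundamentalForm h g F x u v) := by
  have hFx : MDiffAt F x := F.contMDiff.mdifferentiable (by simp) x
  let Y : ∀ y : M, TangentSpace 𝓘(ℝ, E) y := FiberBundle.extend E v
  have hY : MDiffAt (T% Y) x := FiberBundle.mdifferentiableAt_extend 𝓘(ℝ, E) E v
  have hv : Y x = v := FiberBundle.extend_apply_self ..
  have h1 := _root_.secondFundamentalForm_apply h g F hY u
  have h2 := _root_.secondFundamentalForm_apply h g F (P.mdifferentiableAt_apply hY) u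
  have h3 := covDerivAlong_endo g Q hFx (mdifferentiableAt_pushforward F hY) u
  have h4 : pushforward F (fun y ↦ P.val y (Y y)) = fun y ↦ Q.val (F y) (pushforward F Y y) :=
    funext fun y ↦ hF y (Y y)
  have h5 := covDerivEndo_apply h P hY u
  have h6 : pushforward F Y x = mfderiv 𝓘(ℝ, E) 𝓘(ℝ, E') F x v := by rw [pushforward, hv]
  rw [hv] at h1 h2 h5
  rw [h4, h3, h6] at h2
  rw [h1, h2, h5, map_sub, map_sub, hF]
  abel

theorem IsAlmostProductRiemannian.metricTrace_top {h : SemiRiemannianMetric E M}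
    {P : AlmostProductStructure E M} (hP : IsAlmostProductRiemannian h P) {x : M} {V : Type*}
    [AddCommGroup V] [Module ℝ V]
    (B : TangentSpace 𝓘(ℝ, E) x →ₗ[ℝ] TangentSpace 𝓘(ℝ, E) x →ₗ[ℝ] V) :
    metricTrace h x ⊤ (fun u v ↦ B u v) =
      metricTrace h x (eigendistribution P 1 x) (fun u v ↦ B u v) +
        metricTrace h x (eigendistribution P (-1) x) (fun u v ↦ B u v) :=
  metricTrace_top_of_isCompl h hP.1 (isCompl_eigendistribution P x)
    (fun _ hu _ hv ↦ hP.2.val_eq_zero hu hv) B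

/-- For `v` in the `c`-eigenspace, anticommutation gives `P (∇_u P)v = -(∇_u P)(Pv) = -c (∇_u P)v`.
Every term of the trace thus has eigenvalue `-c`. -/
theorem apply_metricTrace_covDerivEndo (c : ℝ) (x : M) :
    P.val x (metricTrace h x (eigendistribution P c x) (covDerivEndo h P x)) =
      -c • metricTrace h x (eigendistribution P c x) (covDerivEndo h P x) := by
  have h1 := metricTrace_map h (D := eigendistribution P c x)
    (P.val x : TangentSpace 𝓘(ℝ, E) x →ₗ[ℝ] TangentSpace 𝓘(ℝ, E) x) (covDerivEndo h P x)
  have h2 := metricTrace_map h (D := eigendistribution P c x)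
    (-c • (LinearMap.id : TangentSpace 𝓘(ℝ, E) x →ₗ[ℝ] TangentSpace 𝓘(ℝ, E) x))
    (covDerivEndo h P x)
  refine h1.symm.trans (Eq.trans (metricTrace_congr h fun u _ v hv ↦ ?_) h2)
  have h3 := covDerivEndo_apply_apply h P u v
  rw [(mem_eigendistribution P).1 hv] at h3
  have h4 : covDerivEndo h P x u (c • v) = c • covDerivEndo h P x u v :=
    map_smul (covDerivEndoBilin h P x u) c v
  rw [h4] at h3
  change P.val x (covDerivEndo h P x u v) = -c • covDerivEndo h P x u v
  rw [neg_smul, h3, neg_neg]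

/-- The two components of the divergence of `P` in the eigendistributions vanish separately. -/
theorem IsSemiDecomposable.metricTrace_covDerivEndo {h : SemiRiemannianMetric E M}
    {P : AlmostProductStructure E M} (hM : IsSemiDecomposable h P) (x : M) :
    metricTrace h x (eigendistribution P 1 x) (covDerivEndo h P x) = 0 ∧
      metricTrace h x (eigendistribution P (-1) x) (covDerivEndo h P x) = 0 := by
  have h1 : metricTrace h x (eigendistribution P 1 x) (covDerivEndo h P x) +
      metricTrace h x (eigendistribution P (-1) x) (covDerivEndo h P x) = 0 :=
    (hM.1.metricTrace_top (covDerivEndoBilin h P x)).symm.trans (hM.2 x)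
  have h2 := apply_metricTrace_covDerivEndo h P 1 x
  have h3 := apply_metricTrace_covDerivEndo h P (-1) x
  rw [neg_neg] at h3
  -- The roles are crossed: the trace over the `(-1)`-eigenspace is the eigenvector for `1`, and
  -- conversely.
  exact (P.eq_zero_of_add_eq_zero ((mem_eigendistribution P).2 h3) ((mem_eigendistribution P).2 h2)
    (by rwa [add_comm])).symm

/-- Along an eigendistribution of `P` for `c = ±1`, the tension field of a paraholomorphic map
satisfies `Q T = c T + dF (tr ∇P)` if the eigendistribution of `Q` for `c` is Vidal. -/
theorem IsParaholomorphic.apply_tensionField [T2Space N] (hF : IsParaholomorphic P Q F) {c : ℝ}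
    (hc : c * c = 1) (hQ : IsVidal g (eigendistribution Q c)) (x : M) :
    Q.val (F x) (tensionField h g F (eigendistribution P c) x) =
      c • tensionField h g F (eigendistribution P c) x + mfderiv 𝓘(ℝ, E) 𝓘(ℝ, E') F x
        (metricTrace h x (eigendistribution P c x) (covDerivEndo h P x)) := by
  let S := secondFundamentalFormBilin h g F x
  let R := covDerivEndoBilin h P x
  let dF : TangentSpace 𝓘(ℝ, E) x →ₗ[ℝ] TangentSpace 𝓘(ℝ, E') (F x) :=
    (mfderiv 𝓘(ℝ, E) 𝓘(ℝ, E') F x : TangentSpace 𝓘(ℝ, E) x →L[ℝ] TangentSpace 𝓘(ℝ, E') (F x))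
  let q : TangentSpace 𝓘(ℝ, E') (F x) →ₗ[ℝ] TangentSpace 𝓘(ℝ, E') (F x) :=
    (Q.val (F x) : TangentSpace 𝓘(ℝ, E') (F x) →L[ℝ] TangentSpace 𝓘(ℝ, E') (F x))
  let L : TangentSpace 𝓘(ℝ, E') (F x) →ₗ[ℝ] TangentSpace 𝓘(ℝ, E') (F x) := c • LinearMap.id - q
  -- The map `(c - Q) S + dF ∘ ∇P` is controlled only on the diagonal, since the Vidal condition
  -- speaks of `∇_X X` alone; for a trace against a symmetric matrix that is enough.
  have h1 : metricTrace h x (eigendistribution P c x) (fun u v ↦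
      (S.compr₂ L + R.compr₂ dF) u v) = 0 := by
    refine metricTrace_eq_zero_of_diagonal h _ fun u hu ↦ ?_
    have hu' := (mem_eigendistribution P).1 hu
    have hdF : mfderiv 𝓘(ℝ, E) 𝓘(ℝ, E') F x u ∈ eigendistribution Q c (F x) := by
      rw [mem_eigendistribution, ← hF, hu', map_smul]
    have h2 := hF.secondFundamentalForm_apply h P g Q F u u
    rw [covDerivEndo_self_of_isVidal g Q hc hQ hdF, hu', zero_add] at h2
    have h3 : secondFundamentalForm h g F x u (c • u) = c • secondFundamentalForm h g F x u u :=
      map_smul (S u) c u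
    rw [h3] at h2
    change c • secondFundamentalForm h g F x u u -
      Q.val (F x) (secondFundamentalForm h g F x u u) +
      mfderiv 𝓘(ℝ, E) 𝓘(ℝ, E') F x (covDerivEndo h P x u u) = 0
    rw [← h2]
    abel
  have h4 := (metricTrace_add h (fun u v ↦ L (S u v))
    (fun u v ↦ dF (R u v))).symm.trans h1
  rw [metricTrace_map, metricTrace_map] at h4
  have h5 : c • tensionField h g F (eigendistribution P c) x -
      Q.val (F x) (tensionField h g F (eigendistribution P c) x) +
      mfderiv 𝓘(ℝ, E) 𝓘(ℝ, E') F x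
        (metricTrace h x (eigendistribution P c x) (covDerivEndo h P x)) = 0 := h4
  rw [sub_add_eq_add_sub, sub_eq_zero] at h5
  exact h5.symm

theorem IsParaholomorphic.isHarmonic_iff [T2Space N] (hF : IsParaholomorphic P Q F)
    (hM : IsSemiDecomposable h P) (hQ_plus : IsVidal g (eigendistribution Q 1))
    (hQ_minus : IsVidal g (eigendistribution Q (-1))) :
    IsHarmonic h g F ↔ IsPlusEigenHarmonic h P g F ∧ IsMinusEigenHarmonic h P g F := by
  have hsum : ∀ x, tensionField h g F (fun _ ↦ ⊤) x =
      tensionField h g F (eigendistribution P 1) x +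
        tensionField h g F (eigendistribution P (-1)) x := fun x ↦
    hM.1.metricTrace_top (secondFundamentalFormBilin h g F x)
  constructor
  · intro hH
    have key : ∀ x, tensionField h g F (eigendistribution P 1) x = 0 ∧
        tensionField h g F (eigendistribution P (-1)) x = 0 := by
      intro x
      have h1 := hF.apply_tensionField h P g Q F (one_mul 1) hQ_plus x
      have h2 := hF.apply_tensionField h P g Q F (by norm_num) hQ_minus x
      rw [(hM.metricTrace_covDerivEndo x).1, map_zero, add_zero] at h1
      rw [(hM.metricTrace_covDerivEndo x).2, map_zero, add_zero] at h2
      have h3 := (hsum x).symm.trans (hH x)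
      -- With the `∇P` terms gone, the two partial tension fields are eigenvectors of `Q` for `1`
      -- and `-1`, and harmonicity says that their sum is zero.
      exact Q.eq_zero_of_add_eq_zero ((mem_eigendistribution Q).2 h1)
        ((mem_eigendistribution Q).2 h2) h3
    exact ⟨fun x ↦ (key x).1, fun x ↦ (key x).2⟩
  · rintro ⟨h1, h2⟩ x
    rw [hsum, h1 x, h2 x, add_zero]

end Harmonic

/-! ### The main theorem, with both signs of paraholomorphy -/

theorem mainTheorem3
    {E : Type*} [NormedAddCommGroup E] [NormedSpace ℝ E] [FiniteDimensional ℝ E]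
    {M : Type*} [TopologicalSpace M] [T2Space M] [SecondCountableTopology M]
    [ChartedSpace E M] [IsManifold 𝓘(ℝ, E) ∞ M]
    {E' : Type*} [NormedAddCommGroup E'] [NormedSpace ℝ E'] [FiniteDimensional ℝ E']
    {N : Type*} [TopologicalSpace N] [T2Space N] [SecondCountableTopology N]
    [ChartedSpace E' N] [IsManifold 𝓘(ℝ, E') ∞ N]
    (h : SemiRiemannianMetric E M) (P : AlmostProductStructure E M)
    (g : SemiRiemannianMetric E' N) (Q : AlmostProductStructure E' N)
    (F : C^∞⟮𝓘(ℝ, E), M; 𝓘(ℝ, E'), N⟯)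
    (hM : IsSemiDecomposable h P)
    (hN : IsAlmostProductRiemannian g Q ∨ IsAlmostParaHermitian g Q)
    (hQ_plus : IsVidal g (eigendistribution Q 1))
    (hQ_minus : IsVidal g (eigendistribution Q (-1)))
    (hF : IsParaholomorphic P Q F ∨ IsAntiParaholomorphic P Q F) :
    IsHarmonic h g F ↔ IsPlusEigenHarmonic h P g F ∧ IsMinusEigenHarmonic h P g F := by
  rcases hF with hF | hF
  · exact hF.isHarmonic_iff h P g Q F hM hQ_plus hQ_minus
  -- By definition `hF` says that `F` is `(P, -Q)`-paraholomorphic. The eigendistributions of `-Q`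
  -- are those of `Q` exchanged, so the two Vidal hypotheses trade places.
  · refine IsParaholomorphic.isHarmonic_iff h P g (-Q) F hF hM ?_ ?_
    · rwa [eigendistribution_neg]
    · rwa [eigendistribution_neg, neg_neg]
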